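/- Let $N\ge 2$ be an integer and let $$E_N=\Big\{v\in W^{1,N}(0,1): v(0)=0,\ \int_0^1|v'|^N\,ds=1\Big\},$$ where $v(0)$ is the value at $0$ of the continuous representative of $v$ on $[0,1]$. For $\gamma\in\mathbb R$ let $$J_\gamma(v)=\int_0^1 \exp\Big(\Big(\log\frac es+\gamma\log\log\frac es\Big)\frac{v(s)^N}{s^{N-1}}\Big)\,ds\in[0,\infty].$$ For integers $j\ge1$ let $w_j(t)=j^{1/N}t$ for $0\le t\le \frac1j$ and $w_j(t)=j^{-(N-1)/N}$ for $\frac1j\le t\le1$ (the infinitesimal Moser sequence). Then the following hold. 1. For every $\gamma\in\mathbb R$: $\ \sup_{v\in E_N}J_\gamma(v)<\infty$ if and only if $\gamma\le1$. 2. For $\gamma=1$ compactness is lost: $w_j\in E_N$ for all $j\ge1$ and $w_j\rightharpoonup0$ weakly in $W^{1,N}(0,1)$, but $J_1(w_j)\not\to J_1(0)$ as $j\to\infty$. 3. More precisely, $J_\gamma(0)=1$ for every $\gamma\in\mathbb R$, and as $j\to\infty$: if $\gamma>1$, then $J_\gamma(w_j)\to+\infty$; if $\gamma=1$, then $J_1(w_j)$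 converges to a finite limit $c\ge e+1>1=J_1(0)$; if $\gamma<1$, then $J_\gamma(w_j)\to1=J_\gamma(0)$. -/

import Mathlib

open MeasureTheory Set Filter Topology
open scoped ENNReal ContDiff

namespace BlissMoser

/-- Lebesgue measure on the open unit interval. -/
noncomputable abbrev unitMeasure : Measure ℝ := volume.restrict (Ioo (0 : ℝ) 1)

/-- `φ` is a test function on `(0,1)`: smooth with compact support inside `(0,1)`. -/
structure IsTest (φ : ℝ → ℝ) : Prop where
  smooth : ContDiff ℝ ∞ φ
  compactSupport : HasCompactSupport φ
  support_subset : tsupport φ ⊆ Ioo (0 : ℝ) 1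

/-- `g` is a weak derivative of `u` on `(0,1)`. (Only used for integrable `u` and `g`.) -/
def IsWeakDeriv (u g : ℝ → ℝ) : Prop :=
  ∀ φ : ℝ → ℝ, IsTest φ →
    ∫ x in Ioo (0 : ℝ) 1, u x * deriv φ x = -∫ x in Ioo (0 : ℝ) 1, g x * φ x

instance fact_one_le_exponent (N : ℕ) [h : Fact (2 ≤ N)] : Fact ((1 : ℝ≥0∞) ≤ (N : ℝ≥0∞)) :=
  ⟨by exact_mod_cast (by norm_num : 1 ≤ 2).trans h.out⟩

theorem integrable_lp_mul {N : ℕ} [Fact (2 ≤ N)] (u : Lp ℝ (N : ℝ≥0∞) unitMeasure)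
    {ψ : ℝ → ℝ} (hc : Continuous ψ) (hs : HasCompactSupport ψ) :
    Integrable (fun x => u x * ψ x) unitMeasure := by
  obtain ⟨C, hC⟩ := hc.bounded_above_of_compact_support hs
  exact ((Lp.memLp u).integrable Fact.out).mul_bdd
    hc.aestronglyMeasurable (Eventually.of_forall hC)

theorem IsTest.continuous_deriv {φ : ℝ → ℝ} (h : IsTest φ) : Continuous (deriv φ) :=
  h.smooth.continuous_deriv (by simp)

/-- The Sobolev space `W^{1,N}(0,1)`: pairs `(u, u')` of `L^N(0,1)` functions such that `u'` is the
weak derivative of `u`, with the norm `(‖u‖_N ^ N + ‖u'‖_N ^ N) ^ (1/N)`. The second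
component is determined by the first one. -/
noncomputable def W1 (N : ℕ) [Fact (2 ≤ N)] :
    Submodule ℝ (WithLp (N : ℝ≥0∞)
      (Lp ℝ (N : ℝ≥0∞) unitMeasure × Lp ℝ (N : ℝ≥0∞) unitMeasure)) where
  carrier := {p | IsWeakDeriv p.fst p.snd}
  zero_mem' := by
    intro φ _
    have h0 := Lp.coeFn_zero ℝ (N : ℝ≥0∞) unitMeasure
    have h1 : ∀ ψ : ℝ → ℝ, ∫ x in Ioo (0 : ℝ) 1,
        (0 : Lp ℝ (N : ℝ≥0∞) unitMeasure) x * ψ x = 0 := by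
      intro ψ
      refine integral_eq_zero_of_ae ?_
      filter_upwards [h0] with x hx
      simp only [hx, Pi.zero_apply, zero_mul]
    change ∫ x in Ioo (0 : ℝ) 1, (0 : Lp ℝ (N : ℝ≥0∞) unitMeasure) x * deriv φ x
      = -∫ x in Ioo (0 : ℝ) 1, (0 : Lp ℝ (N : ℝ≥0∞) unitMeasure) x * φ x
    rw [h1, h1, neg_zero]
  add_mem' := by
    intro p q hp hq φ hφ
    have key : ∀ (a b : Lp ℝ (N : ℝ≥0∞) unitMeasure) (ψ : ℝ → ℝ), Continuous ψ →
        HasCompactSupport ψ → ∫ x in Ioo (0 : ℝ) 1, (a + b) x * ψ x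
          = (∫ x in Ioo (0 : ℝ) 1, a x * ψ x) + ∫ x in Ioo (0 : ℝ) 1, b x * ψ x := by
      intro a b ψ hc hs
      rw [← integral_add (integrable_lp_mul a hc hs) (integrable_lp_mul b hc hs)]
      refine integral_congr_ae ?_
      filter_upwards [Lp.coeFn_add a b] with x hx
      rw [hx, Pi.add_apply, add_mul]
    change ∫ x in Ioo (0 : ℝ) 1, (p.fst + q.fst) x * deriv φ x
      = -∫ x in Ioo (0 : ℝ) 1, (p.snd + q.snd) x * φ x
    rw [key _ _ _ hφ.continuous_deriv hφ.compactSupport.deriv,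
      key _ _ _ hφ.smooth.continuous hφ.compactSupport, hp φ hφ, hq φ hφ, neg_add]
  smul_mem' := by
    intro c p hp φ hφ
    have key : ∀ (a : Lp ℝ (N : ℝ≥0∞) unitMeasure) (ψ : ℝ → ℝ),
        ∫ x in Ioo (0 : ℝ) 1, (c • a) x * ψ x = c * ∫ x in Ioo (0 : ℝ) 1, a x * ψ x := by
      intro a ψ
      rw [← integral_const_mul]
      refine integral_congr_ae ?_
      filter_upwards [Lp.coeFn_smul c a] with x hx
      rw [hx, Pi.smul_apply, smul_eq_mul, mul_assoc]
    change ∫ x in Ioo (0 : ℝ) 1, (c • p.fst) x * deriv φ x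
      = -∫ x in Ioo (0 : ℝ) 1, (c • p.snd) x * φ x
    rw [key, key, hp φ hφ, mul_neg]

/-- A function representing an element of `W^{1,N}(0,1)`. -/
noncomputable def rep {N : ℕ} [Fact (2 ≤ N)] (v : W1 N) : ℝ → ℝ := v.1.fst

/-- The weak derivative of an element of `W^{1,N}(0,1)`. -/
noncomputable def weakDeriv {N : ℕ} [Fact (2 ≤ N)] (v : W1 N) : ℝ → ℝ := v.1.snd

/-- `E_N = {v ∈ W^{1,N}(0,1) : v(0) = 0, ∫₀¹ |v'|^N = 1}`; the value at `0` is that of the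
continuous representative on `[0,1]`. -/
def E (N : ℕ) [Fact (2 ≤ N)] : Set (W1 N) :=
  {v | (∃ f : ℝ → ℝ, ContinuousOn f (Icc 0 1) ∧ f =ᵐ[unitMeasure] rep v ∧ f 0 = 0) ∧
    ∫ x in Ioo (0 : ℝ) 1, |weakDeriv v x| ^ N = 1}

/-- `J_γ(v) = ∫₀¹ exp((log(e/s) + γ log log(e/s)) v(s)^N / s^(N-1)) ds`, with values in `[0,∞]`.
It depends only on the almost everywhere class of `v` on `(0,1)`. -/
noncomputable def J (N : ℕ) (γ : ℝ) (v : ℝ → ℝ) : ℝ≥0∞ :=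
  ∫⁻ s in Ioo (0 : ℝ) 1, ENNReal.ofReal (Real.exp
    ((Real.log (Real.exp 1 / s) + γ * Real.log (Real.log (Real.exp 1 / s))) *
      (v s ^ N / s ^ (N - 1))))

/-- The infinitesimal Moser functions `w_j`, `j ≥ 1`. -/
noncomputable def moser (N j : ℕ) (t : ℝ) : ℝ :=
  if t ≤ 1 / (j : ℝ) then (j : ℝ) ^ (1 / (N : ℝ)) * t
  else 1 / (j : ℝ) ^ (((N : ℝ) - 1) / (N : ℝ))

end BlissMoser

namespace BlissMoser

/-! Finiteness for γ ≤ 1. Put h(s) = |v(s)|^N / s^(N-1) and let M(s) be the energy of v on (0, s).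
Hölder gives h ≤ M ≤ 1, but this alone is not enough: at h = 1 the critical integrand is (e/s)
log(e/s), which is not integrable. The gain comes from near-extremality being possible only near one
point. If h ≥ 1 - μ at both s ≤ t, then only energy μ is left on (s, t), so v barely grows there,
and this forces 1 - s/t ≤ 4^N μ (`deficit_ge`). Comparing every s with a maximum point a of h gives
h(s) ≤ 1 - 4^(-N) (1 - exp(-|log(s/a)|)) (`exists_concentration_point`). With A = log(e/a), the
integrand near a is at most a constant times (A/s) exp(-c A |log(s/a)|), whose integral is bounded
independently of a; away from a, h stays below a constant less than 1 and the integral is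
subcritical (`lintegral_exp_weight_mul_le`).

Behaviour along the Moser functions. Here h = exp(min(r, -(N-1) r)) with r = log(js). On the window
|r| ≤ 1, write l = 1 + log j and r = ±x/l. For γ = 1 the exponent together with the logarithm of the
Jacobian tends to 1 - x on the left and to 1 - (N-1) x on the right, so the window contributes e +
e/(N-1). Outside it h ≤ 1/e, and dominated convergence gives 1. Hence the limit is c = e + e/(N-1) +
1. Passing to another γ multiplies the integrand by exp((γ-1) h log log(e/s)), which on the window
tends uniformly to 0 or ∞; for γ > 1 this also makes the supremum infinite.

Weak convergence. The functions tend to 0 in norm. The derivatives are handled by superposing bumps: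
K of them, sufficiently separated in scale, have norm only of order K^(1/N), so a bounded functional
cannot exceed a fixed ε > 0 on infinitely many. -/

/-! ### The critical weight and its exponential integrals. -/

theorem log_exp_one_div {s : ℝ} (hs : 0 < s) : Real.log (Real.exp 1 / s) = 1 - Real.log s := by
  rw [Real.log_div (Real.exp_ne_zero _) hs.ne', Real.log_exp]

theorem one_le_log_exp_one_div {s : ℝ} (hs : 0 < s) (hs1 : s ≤ 1) :
    1 ≤ Real.log (Real.exp 1 / s) := by
  rw [log_exp_one_div hs]
  linarith [Real.log_nonpos hs.le hs1]

/-- The critical weight `log (e/s) + log log (e/s)`. -/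
noncomputable def weight (s : ℝ) : ℝ :=
  Real.log (Real.exp 1 / s) + Real.log (Real.log (Real.exp 1 / s))

theorem measurable_weight : Measurable weight := by
  unfold weight
  fun_prop

theorem weight_nonneg {s : ℝ} (hs : 0 < s) (hs1 : s ≤ 1) : 0 ≤ weight s := by
  have h := one_le_log_exp_one_div hs hs1
  have := Real.log_nonneg h
  unfold weight
  linarith

theorem log_le_weight {s : ℝ} (hs : 0 < s) (hs1 : s ≤ 1) :
    Real.log (Real.exp 1 / s) ≤ weight s :=
  le_add_of_nonneg_right (Real.log_nonneg (one_le_log_exp_one_div hs hs1))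

theorem exp_weight {s : ℝ} (hs : 0 < s) (hs1 : s ≤ 1) :
    Real.exp (weight s) = Real.exp 1 / s * Real.log (Real.exp 1 / s) := by
  have h := one_le_log_exp_one_div hs hs1
  rw [weight, Real.exp_add, Real.exp_log (by positivity), Real.exp_log (by linarith)]

/-- The double logarithm costs only a fraction ε of log(e/s), by log y ≤ y - 1 at y = ε log(e/s).
The integrand is then at most a constant times s^(-q(1+ε)), and ε = (1-q)/2 keeps q(1+ε) below 1. -/
theorem lintegral_exp_mul_weight_lt_top {q : ℝ} (hq0 : 0 ≤ q) (hq1 : q < 1) :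
    ∫⁻ s in Ioo (0 : ℝ) 1, ENNReal.ofReal (Real.exp (q * weight s)) < ⊤ := by
  obtain ⟨ε, hε⟩ : ∃ ε, ε = (1 - q) / 2 := ⟨_, rfl⟩
  have hε0 : 0 < ε := by rw [hε]; linarith
  obtain ⟨p, hp⟩ : ∃ p, p = q * (1 + ε) := ⟨_, rfl⟩
  have hp1 : p < 1 := by rw [hp, hε]; nlinarith
  obtain ⟨K, hK⟩ : ∃ K, K = q * ((1 + ε) - (1 + Real.log ε)) := ⟨_, rfl⟩
  have hint : IntegrableOn (fun s : ℝ => Real.exp K * s ^ (-p)) (Ioo 0 1) :=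
    (((intervalIntegral.integrableOn_Ioo_rpow_iff one_pos).2 (by linarith))).const_mul _
  refine lt_of_le_of_lt ?_ hint.lintegral_lt_top
  refine setLIntegral_mono' measurableSet_Ioo fun s hs => ENNReal.ofReal_le_ofReal ?_
  have hL := one_le_log_exp_one_div hs.1 hs.2.le
  rw [Real.rpow_def_of_pos hs.1, ← Real.exp_add, Real.exp_le_exp]
  have h1 := Real.log_le_sub_one_of_pos (show 0 < ε * Real.log (Real.exp 1 / s) by positivity)
  rw [Real.log_mul hε0.ne' (by linarith)] at h1
  have h2 : weight s ≤ (1 + ε) * (1 - Real.log s) - (1 + Real.log ε) := by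
    unfold weight
    rw [log_exp_one_div hs.1] at h1 ⊢
    linarith
  calc q * weight s ≤ q * ((1 + ε) * (1 - Real.log s) - (1 + Real.log ε)) := by gcongr
    _ = K + Real.log s * -p := by rw [hK, hp]; ring

/-- In the variable u = log(s/a) this is the integral of exp(-k|u|) over the line. The decay in k is
what later absorbs the factor log(e/a). -/
theorem lintegral_inv_mul_exp_neg_abs_log_le {a k : ℝ} (ha : 0 < a) (hk : 0 < k) :
    ∫⁻ s in Ioi (0 : ℝ), ENNReal.ofReal (s⁻¹ * Real.exp (-(k * |Real.log (s / a)|)))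
      ≤ ENNReal.ofReal (2 / k) := by
  have h1 : ∫⁻ s in Ioc (0 : ℝ) a, ENNReal.ofReal (s⁻¹ * Real.exp (-(k * |Real.log (s / a)|)))
      = ENNReal.ofReal (1 / k) := by
    have hi : IntegrableOn (fun s : ℝ => a ^ (-k) * s ^ (k - 1)) (Ioc 0 a) := by
      rw [← intervalIntegrable_iff_integrableOn_Ioc_of_le ha.le]
      exact (intervalIntegral.intervalIntegrable_rpow' (by linarith)).const_mul _
    have hv : ∫ s in Ioc 0 a, a ^ (-k) * s ^ (k - 1) = 1 / k := by
      rw [← intervalIntegral.integral_of_le ha.le, intervalIntegral.integral_const_mul,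
        integral_rpow (Or.inl (by linarith)), sub_add_cancel, Real.zero_rpow hk.ne', sub_zero,
        ← mul_div_assoc, ← Real.rpow_add ha, neg_add_cancel, Real.rpow_zero]
    rw [← hv, ofReal_integral_eq_lintegral_ofReal hi ?_]
    · refine setLIntegral_congr_fun measurableSet_Ioc fun s hs => ?_
      have : Real.log (s / a) ≤ 0 :=
        Real.log_nonpos (div_pos hs.1 ha).le ((div_le_one ha).2 hs.2)
      rw [abs_of_nonpos this, Real.rpow_def_of_pos ha, Real.rpow_def_of_pos hs.1,
        ← Real.exp_log (inv_pos.2 hs.1), ← Real.exp_add, ← Real.exp_add, Real.log_inv,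
        Real.log_div hs.1.ne' ha.ne']
      ring_nf
    · filter_upwards [ae_restrict_mem measurableSet_Ioc] with s hs
      exact mul_nonneg (Real.rpow_nonneg ha.le _) (Real.rpow_nonneg hs.1.le _)
  have h2 : ∫⁻ s in Ioi a, ENNReal.ofReal (s⁻¹ * Real.exp (-(k * |Real.log (s / a)|)))
      = ENNReal.ofReal (1 / k) := by
    have hi : IntegrableOn (fun s : ℝ => a ^ k * s ^ (-k - 1)) (Ioi a) :=
      (integrableOn_Ioi_rpow_of_lt (by linarith) ha).const_mul _
    have hv : ∫ s in Ioi a, a ^ k * s ^ (-k - 1) = 1 / k := by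
      rw [integral_const_mul, integral_Ioi_rpow_of_lt (by linarith) ha, sub_add_cancel,
        ← mul_div_assoc, mul_neg, ← Real.rpow_add ha, add_neg_cancel, Real.rpow_zero,
        neg_div_neg_eq]
    rw [← hv, ofReal_integral_eq_lintegral_ofReal hi ?_]
    · refine setLIntegral_congr_fun measurableSet_Ioi fun s hs => ?_
      have hs0 : 0 < s := ha.trans hs
      have : 0 ≤ Real.log (s / a) := Real.log_nonneg ((one_le_div ha).2 (le_of_lt hs))
      rw [abs_of_nonneg this, Real.rpow_def_of_pos ha, Real.rpow_def_of_pos hs0,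
        ← Real.exp_log (inv_pos.2 hs0), ← Real.exp_add, ← Real.exp_add, Real.log_inv,
        Real.log_div hs0.ne' ha.ne']
      ring_nf
    · filter_upwards [ae_restrict_mem measurableSet_Ioi] with s hs
      exact mul_nonneg (Real.rpow_nonneg ha.le _) (Real.rpow_nonneg (ha.trans hs).le _)
  rw [← Ioc_union_Ioi_eq_Ioi ha.le]
  refine (lintegral_union_le _ _ _).trans ?_
  rw [h1, h2, ← ENNReal.ofReal_add (by positivity) (by positivity)]
  exact ENNReal.ofReal_le_ofReal (by ring_nf; rfl)

theorem half_le_one_sub_exp_neg_of_le_one {y : ℝ} (hy : 0 ≤ y) (hy1 : y ≤ 1) :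
    y / 2 ≤ 1 - Real.exp (-y) := by
  have h := Real.add_one_le_exp y
  have : Real.exp (-y) ≤ 1 / (1 + y) := by
    rw [Real.exp_neg, ← one_div]
    exact one_div_le_one_div_of_le (by linarith) (by linarith)
  have h2 : 1 / (1 + y) ≤ 1 - y / 2 := by
    rw [div_le_iff₀ (by linarith)]
    nlinarith
  linarith

theorem half_le_one_sub_exp_neg_of_one_le {y : ℝ} (hy : 1 ≤ y) : 1 / 2 ≤ 1 - Real.exp (-y) := by
  have h := half_le_one_sub_exp_neg_of_le_one zero_le_one le_rfl
  have : Real.exp (-y) ≤ Real.exp (-1) := Real.exp_le_exp.2 (by linarith)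
  linarith

/-- A function bounded by `1`, with a deficit that grows linearly with the logarithmic distance to
a concentration point, has a controlled critical exponential integral. -/
theorem lintegral_exp_weight_mul_le {c a : ℝ} (hc : 0 < c) (ha : 0 < a)
    (ha1 : a ≤ 1) {h : ℝ → ℝ}
    (hh : ∀ s ∈ Ioo (0 : ℝ) 1, h s ≤ 1 - c * (1 - Real.exp (-|Real.log (s / a)|))) :
    ∫⁻ s in Ioo (0 : ℝ) 1, ENNReal.ofReal (Real.exp (weight s * h s)) ≤
      ENNReal.ofReal (16 * Real.exp 1 / c) +
        ∫⁻ s in Ioo (0 : ℝ) 1, ENNReal.ofReal (Real.exp ((1 - c / 2) * weight s)) := by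
  obtain ⟨A, hA⟩ : ∃ A, A = Real.log (Real.exp 1 / a) := ⟨_, rfl⟩
  have hA1 : 1 ≤ A := hA ▸ one_le_log_exp_one_div ha ha1
  have key : ∀ s ∈ Ioo (0 : ℝ) 1, Real.exp (weight s * h s) ≤
      2 * Real.exp 1 * A * (s⁻¹ * Real.exp (-(c * A / 4 * |Real.log (s / a)|)))
        + Real.exp ((1 - c / 2) * weight s) := by
    intro s hs
    have hW := weight_nonneg hs.1 hs.2.le
    have hLW := log_le_weight hs.1 hs.2.le
    have hL := one_le_log_exp_one_div hs.1 hs.2.le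
    have hmul := mul_le_mul_of_nonneg_left (hh s hs) hW
    have hs0 : 0 < s := hs.1
    obtain ⟨y, hy⟩ : ∃ y, y = |Real.log (s / a)| := ⟨_, rfl⟩
    rw [← hy] at hmul ⊢
    have hy0 : 0 ≤ y := hy ▸ abs_nonneg _
    -- Within logarithmic distance 1 of a, log(e/s) lies between A/2 and 2A and the linear deficit
    -- is used. Farther away the deficit is at least c/2, which makes the exponent subcritical.
    rcases le_total y 1 with hy1 | hy1
    · refine le_add_of_le_of_nonneg ?_ (Real.exp_pos _).le
      have hd := half_le_one_sub_exp_neg_of_le_one hy0 hy1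
      have hdist : |Real.log (Real.exp 1 / s) - A| ≤ 1 := by
        rw [hA, log_exp_one_div ha, log_exp_one_div hs.1]
        rw [hy, Real.log_div hs.1.ne' ha.ne'] at hy1
        rwa [abs_sub_comm, ← sub_sub_sub_cancel_left _ _ 1] at hy1
      rw [abs_le] at hdist
      have hLA : A / 2 ≤ Real.log (Real.exp 1 / s) := by linarith
      have hAW : A / 2 * (c * (y / 2)) ≤ weight s * (c * (1 - Real.exp (-y))) := by
        have : A / 2 ≤ weight s := hLA.trans hLW
        gcongr
      calc Real.exp (weight s * h s) ≤ Real.exp (weight s + -(c * A / 4 * y)) :=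
            Real.exp_le_exp.2 (by nlinarith)
        _ = Real.exp 1 / s * Real.log (Real.exp 1 / s) * Real.exp (-(c * A / 4 * y)) := by
            rw [Real.exp_add, exp_weight hs.1 hs.2.le]
        _ ≤ Real.exp 1 / s * (2 * A) * Real.exp (-(c * A / 4 * y)) := by
            gcongr
            linarith
        _ = _ := by ring
    · refine le_add_of_nonneg_of_le (by positivity) (Real.exp_le_exp.2 ?_)
      have hd := half_le_one_sub_exp_neg_of_one_le hy1
      have : weight s * (c * (1 / 2)) ≤ weight s * (c * (1 - Real.exp (-y))) := by gcongr
      nlinarith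
  calc ∫⁻ s in Ioo (0 : ℝ) 1, ENNReal.ofReal (Real.exp (weight s * h s))
      ≤ ∫⁻ s in Ioo (0 : ℝ) 1, (ENNReal.ofReal (2 * Real.exp 1 * A) *
          ENNReal.ofReal (s⁻¹ * Real.exp (-(c * A / 4 * |Real.log (s / a)|)))
          + ENNReal.ofReal (Real.exp ((1 - c / 2) * weight s))) := by
        refine setLIntegral_mono' measurableSet_Ioo fun s hs => ?_
        have hs0 : 0 < s := hs.1
        rw [← ENNReal.ofReal_mul (by positivity), ← ENNReal.ofReal_add (by positivity)
          (by positivity)]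
        exact ENNReal.ofReal_le_ofReal (key s hs)
    _ = ENNReal.ofReal (2 * Real.exp 1 * A) * (∫⁻ s in Ioo (0 : ℝ) 1,
          ENNReal.ofReal (s⁻¹ * Real.exp (-(c * A / 4 * |Real.log (s / a)|))))
          + ∫⁻ s in Ioo (0 : ℝ) 1, ENNReal.ofReal (Real.exp ((1 - c / 2) * weight s)) := by
        rw [lintegral_add_right _ (by have := measurable_weight; fun_prop),
          lintegral_const_mul' _ _ ENNReal.ofReal_ne_top]
    _ ≤ _ := by
        gcongr
        refine (mul_le_mul_right ((lintegral_mono_set Ioo_subset_Ioi_self).trans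
          (lintegral_inv_mul_exp_neg_abs_log_le ha (by positivity))) _).trans ?_
        -- With k = cA/4 the integral is at most 8/(cA), so A cancels against the prefactor 2eA and
        -- leaves 16e/c, independent of a.
        rw [← ENNReal.ofReal_mul (by positivity)]
        refine ENNReal.ofReal_le_ofReal (le_of_eq ?_)
        field_simp
        ring

/-! ### Deficit in Hölder's inequality and the concentration point. -/

/-- Two near-extremal points of a Hölder bound are logarithmically close. -/
theorem deficit_ge {N : ℕ} (hN : 2 ≤ N) {s t A B D μ : ℝ} (hs : 0 < s) (hst : s ≤ t)
    (hB : 0 ≤ B) (hBAD : B ≤ A + D)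
    (hAs : A ^ N ≤ s ^ (N - 1)) (hDs : D ^ N ≤ (t - s) ^ (N - 1) * μ)
    (hBt : (1 - μ) * t ^ (N - 1) ≤ B ^ N) (hμ : 0 ≤ μ) :
    (1 / 4) ^ N * (1 - s / t) ≤ μ := by
  by_contra! hlt
  have ht : 0 < t := hs.trans_le hst
  obtain ⟨y, hy⟩ : ∃ y, y = 1 - s / t := ⟨_, rfl⟩
  have hst' : s / t ≤ 1 := (div_le_one ht).2 hst
  have hst0 : 0 < s / t := div_pos hs ht
  have hy1 : y < 1 := by linarith
  have hsy : s = t * (1 - y) := by rw [hy]; field_simp; ring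
  have hty : t - s = t * y := by rw [hsy]; ring
  rw [← hy] at hlt
  have hy0 : 0 < y := by
    by_contra! h
    have : (1 / 4 : ℝ) ^ N * y ≤ 0 := mul_nonpos_of_nonneg_of_nonpos (by positivity) h
    linarith
  -- T is the largest value Hölder allows at t. If μ were too small, then D ≤ Ty/4 and A ≤ T(1 -
  -- y/2), so B ≤ T(1 - y/4). Near-extremality at t then yields μ ≥ y/4, a contradiction.
  obtain ⟨T, hT0, hT⟩ : ∃ T : ℝ, 0 < T ∧ T ^ N = t ^ (N - 1) :=
    ⟨(t ^ (N - 1)) ^ (1 / (N : ℝ)), by positivity, by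
      rw [one_div, Real.rpow_inv_natCast_pow (by positivity) (by omega)]⟩
  have hNN : N = (N - 1) + 1 := by omega
  have hD' : D ≤ T * (y / 4) := by
    refine le_of_pow_le_pow_left₀ (by omega : N ≠ 0) (by positivity) ?_
    calc D ^ N ≤ (t * y) ^ (N - 1) * ((1 / 4) ^ N * y) := by
          rw [← hty]
          refine hDs.trans ?_
          have : 0 ≤ t - s := by linarith
          gcongr
      _ = T ^ N * ((1 / 4) ^ N * (y ^ (N - 1) * y)) := by rw [mul_pow, hT]; ring
      _ = T ^ N * ((1 / 4) ^ N * y ^ N) := by rw [← pow_succ, ← hNN]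
      _ = (T * (y / 4)) ^ N := by rw [← mul_pow, ← mul_pow]; ring
  have hA' : A ≤ T * (1 - y / 2) := by
    have h0 : 0 < 1 - y := by linarith
    have h1 : 0 < 1 - y / 2 := by linarith
    refine le_of_pow_le_pow_left₀ (by omega : N ≠ 0) (by positivity) ?_
    calc A ^ N ≤ (t * (1 - y)) ^ (N - 1) := by rw [← hsy]; exact hAs
      _ = T ^ N * (1 - y) ^ (N - 1) := by rw [mul_pow, hT]
      _ ≤ T ^ N * ((1 - y / 2) ^ 2) ^ (N - 1) := by
          gcongr
          nlinarith
      _ = T ^ N * (1 - y / 2) ^ (2 * (N - 1)) := by rw [← pow_mul]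
      _ ≤ T ^ N * (1 - y / 2) ^ N := by
          refine mul_le_mul_of_nonneg_left ?_ (by positivity)
          -- Here N ≥ 2 enters, as 2(N-1) ≥ N.
          exact pow_le_pow_of_le_one h1.le (by linarith) (by omega)
      _ = (T * (1 - y / 2)) ^ N := by rw [mul_pow]
  have hB' : B ^ N ≤ T ^ N * (1 - y / 4) := by
    have h1 : 0 ≤ 1 - y / 4 := by linarith
    calc B ^ N ≤ (T * (1 - y / 4)) ^ N := by gcongr; linarith
      _ = T ^ N * (1 - y / 4) ^ N := mul_pow ..
      _ ≤ T ^ N * (1 - y / 4) := by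
          gcongr
          exact pow_le_of_le_one h1 (by linarith) (by omega)
  rw [← hT] at hBt
  have h16 : (1 / 4 : ℝ) ^ N ≤ 1 / 4 ^ 2 := by
    calc (1 / 4 : ℝ) ^ N ≤ (1 / 4) ^ 2 := pow_le_pow_of_le_one (by norm_num) (by norm_num) hN
      _ = 1 / 4 ^ 2 := by norm_num
  have hTN : 0 < T ^ N := by positivity
  have h2 : 1 - μ ≤ 1 - y / 4 := by
    refine le_of_mul_le_mul_right ?_ hTN
    linarith
  nlinarith

/-- The point is a maximiser of h = |f|^N / s^(N-1). At any s, both s and the maximiser have h at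
least h(s), so `deficit_ge` applies with μ = 1 - h(s). -/
theorem exists_concentration_point {N : ℕ} (hN : 2 ≤ N) {f M : ℝ → ℝ}
    (hf : ContinuousOn f (Icc 0 1)) (hf0 : f 0 = 0) (hM : ContinuousOn M (Icc 0 1))
    (hM0 : M 0 = 0) (hM1 : M 1 ≤ 1) (hmono : MonotoneOn M (Icc 0 1))
    (hfM : ∀ s ∈ Icc (0 : ℝ) 1, ∀ t ∈ Icc (0 : ℝ) 1, s ≤ t →
      |f t - f s| ^ N ≤ (t - s) ^ (N - 1) * (M t - M s)) :
    ∃ a : ℝ, 0 < a ∧ a ≤ 1 ∧ ∀ s ∈ Ioo (0 : ℝ) 1, |f s| ^ N / s ^ (N - 1) ≤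
      1 - (1 / 4) ^ N * (1 - Real.exp (-|Real.log (s / a)|)) := by
  have m0 : (0 : ℝ) ∈ Icc (0 : ℝ) 1 := by simp
  have m1 : (1 : ℝ) ∈ Icc (0 : ℝ) 1 := by simp
  have hfle : ∀ s ∈ Icc (0 : ℝ) 1, |f s| ^ N ≤ s ^ (N - 1) * M s := by
    intro s hs
    simpa [hf0, hM0] using hfM 0 m0 s hs hs.1
  obtain ⟨h, hh⟩ : ∃ h : ℝ → ℝ, h = fun s => |f s| ^ N / s ^ (N - 1) := ⟨_, rfl⟩
  have hh0 : h 0 = 0 := by simp [hh, hf0, show N ≠ 0 by omega]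
  have hhnn : ∀ s ∈ Icc (0 : ℝ) 1, 0 ≤ h s := by
    intro s hs
    have := hs.1
    rw [hh]
    positivity
  have hhM : ∀ s ∈ Icc (0 : ℝ) 1, h s ≤ M s := by
    intro s hs
    rcases hs.1.eq_or_lt with h0 | h0
    · rw [← h0, hh0, hM0]
    · rw [hh]
      dsimp only
      rw [div_le_iff₀ (by positivity), mul_comm]
      exact hfle s hs
  have hcont : ContinuousOn h (Icc 0 1) := by
    intro s hs
    rcases hs.1.eq_or_lt with h0 | h0
    -- At 0 the quotient takes the default value 0; continuity there follows by squeezing h between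
    -- 0 and M.
    · subst h0
      have h1 : Tendsto M (𝓝[Icc 0 1] 0) (𝓝 0) := by simpa [hM0] using (hM 0 m0).tendsto
      have : Tendsto h (𝓝[Icc 0 1] 0) (𝓝 0) :=
        squeeze_zero' (eventually_mem_nhdsWithin.mono hhnn)
          (eventually_mem_nhdsWithin.mono hhM) h1
      rw [ContinuousWithinAt, hh0]
      exact this
    · rw [hh]
      exact (((hf s hs).abs).pow N).div (continuousWithinAt_id.pow _) (by positivity)
  have hM1' : ∀ s ∈ Icc (0 : ℝ) 1, M s ≤ 1 := fun s hs => (hmono hs m1 hs.2).trans hM1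
  have hAs : ∀ s ∈ Icc (0 : ℝ) 1, |f s| ^ N ≤ s ^ (N - 1) := fun s hs =>
    (hfle s hs).trans (mul_le_of_le_one_right (pow_nonneg hs.1 _) (hM1' s hs))
  have pair : ∀ s ∈ Icc (0 : ℝ) 1, ∀ t ∈ Icc (0 : ℝ) 1, 0 < s → s ≤ t → ∀ m : ℝ, m ≤ h s →
      m ≤ h t → (1 / 4) ^ N * (1 - s / t) ≤ 1 - m := by
    intro s hs t ht hs0 hst m hms hmt
    have ht0 := hs0.trans_le hst
    refine deficit_ge hN hs0 hst (abs_nonneg (f t))  (D := |f t - f s|) (A := |f s|) ?_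
      (hAs s hs) ((hfM s hs t ht hst).trans ?_) ?_ ?_
    · calc |f t| = |f s + (f t - f s)| := by ring_nf
        _ ≤ _ := abs_add_le _ _
    · refine mul_le_mul_of_nonneg_left ?_ (pow_nonneg (by linarith) _)
      -- The energy left on (s, t) is at most 1 - M(s) ≤ 1 - h(s) ≤ 1 - m.
      linarith [hM1' t ht, hhM s hs]
    · rw [sub_sub_cancel, ← le_div_iff₀ (by positivity)]
      simpa [hh] using hmt
    · linarith [hM1' t ht, hhM t ht]
  obtain ⟨a, ha, hmax⟩ := isCompact_Icc.exists_isMaxOn ⟨0, m0⟩ hcont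
  obtain ⟨b, hb0, hb, hbmax⟩ : ∃ b, 0 < b ∧ b ∈ Icc (0 : ℝ) 1 ∧ ∀ s ∈ Icc (0 : ℝ) 1, h s ≤ h b := by
    -- If the maximum is at 0 then h vanishes identically, and 1 is an equally good maximiser that
    -- is positive.
    rcases ha.1.eq_or_lt with h0 | h0
    · refine ⟨1, one_pos, m1, fun s hs => (hmax hs).trans ?_⟩
      simp only [← h0, hh0, hhnn 1 m1]
    · exact ⟨a, h0, ha, fun s hs => hmax hs⟩
  refine ⟨b, hb0, hb.2, fun s hs => ?_⟩
  have hs' := Ioo_subset_Icc_self hs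
  have hsb := hbmax s hs'
  have hs0 : 0 < s := hs.1
  suffices H : (1 / 4) ^ N * (1 - Real.exp (-|Real.log (s / b)|)) ≤ 1 - h s by
    have : |f s| ^ N / s ^ (N - 1) = h s := by rw [hh]
    linarith
  rcases le_total s b with hle | hle
  · rw [abs_of_nonpos (Real.log_nonpos (by positivity) ((div_le_one hb0).2 hle)), neg_neg,
      Real.exp_log (by positivity)]
    exact pair s hs' b hb hs0 hle _ le_rfl hsb
  · rw [abs_of_nonneg (Real.log_nonneg ((one_le_div hb0).2 hle)), ← Real.log_inv, inv_div,
      Real.exp_log (by positivity)]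
    exact pair b hb s hs' hb0 hle _ hsb le_rfl

/-! ### Weak derivatives and the fundamental theorem of calculus. -/

theorem contDiff_smoothTransition : ContDiff ℝ ∞ Real.smoothTransition :=
  Real.smoothTransition.contDiff

theorem continuous_deriv_smoothTransition : Continuous (deriv Real.smoothTransition) :=
  contDiff_smoothTransition.continuous_deriv (by simp)

theorem hasDerivAt_smoothTransition (x : ℝ) :
    HasDerivAt Real.smoothTransition (deriv Real.smoothTransition x) x :=
  (contDiff_smoothTransition.differentiable (by simp) x).hasDerivAt

theorem hasCompactSupport_deriv_smoothTransition :
    HasCompactSupport (deriv Real.smoothTransition) := by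
  refine HasCompactSupport.intro (isCompact_Icc (a := (0 : ℝ)) (b := 1)) fun x hx => ?_
  rw [mem_Icc, not_and_or, not_le, not_le] at hx
  rcases hx with hx | hx
  · have : Real.smoothTransition =ᶠ[𝓝 x] fun _ => 0 := by
      filter_upwards [Iio_mem_nhds hx] with y hy
      exact Real.smoothTransition.zero_of_nonpos (le_of_lt hy)
    rw [this.deriv_eq, deriv_const]
  · have : Real.smoothTransition =ᶠ[𝓝 x] fun _ => 1 := by
      filter_upwards [Ioi_mem_nhds hx] with y hy
      exact Real.smoothTransition.one_of_one_le (le_of_lt hy)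
    rw [this.deriv_eq, deriv_const]

theorem integral_deriv_smoothTransition : ∫ x, deriv Real.smoothTransition x = 1 := by
  have h := integral_of_hasDerivAt_of_tendsto hasDerivAt_smoothTransition
    (continuous_deriv_smoothTransition.integrable_of_hasCompactSupport
      hasCompactSupport_deriv_smoothTransition)
    (m := 0) (n := 1) ?_ ?_
  · simpa using h
  · refine tendsto_const_nhds.congr' ?_
    filter_upwards [Iic_mem_atBot 0] with y hy
    exact (Real.smoothTransition.zero_of_nonpos hy).symm
  · refine tendsto_const_nhds.congr' ?_
    filter_upwards [Ici_mem_atTop 1] with y hy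
    exact (Real.smoothTransition.one_of_one_le hy).symm

/-- The smooth step `σ ((x - s) / ε)`, which rises from `0` to `1` on `[s, s + ε]`. -/
noncomputable def step (s ε x : ℝ) : ℝ := Real.smoothTransition ((x - s) / ε)

theorem hasDerivAt_step (s ε x : ℝ) :
    HasDerivAt (step s ε) (deriv Real.smoothTransition ((x - s) / ε) * ε⁻¹) x := by
  have := (hasDerivAt_smoothTransition ((x - s) / ε)).comp x
    (((hasDerivAt_id x).sub_const s).div_const ε)
  rw [one_div] at this
  exact this

theorem tendsto_step {s x : ℝ} :
    Tendsto (fun ε => step s ε x) (𝓝[>] 0) (𝓝 ((Ioi s).indicator 1 x)) := by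
  refine tendsto_const_nhds.congr' ?_
  by_cases hx : s < x
  · filter_upwards [Ioo_mem_nhdsGT (sub_pos.2 hx)] with ε hε
    rw [indicator_of_mem (mem_Ioi.2 hx), step, Real.smoothTransition.one_of_one_le]
    · rfl
    · rw [one_le_div hε.1]
      exact hε.2.le
  · filter_upwards [self_mem_nhdsWithin] with ε hε
    rw [indicator_of_notMem (by simpa using hx), step, Real.smoothTransition.zero_of_nonpos]
    exact div_nonpos_of_nonpos_of_nonneg (by linarith) (le_of_lt hε)

/-- The derivatives of the steps form an approximate identity at s: rescaling x = εy + s turns them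
into one fixed density of mass 1. -/
theorem tendsto_integral_mul_deriv_step {f : ℝ → ℝ} (hf : Continuous f) {C : ℝ}
    (hC : ∀ x, |f x| ≤ C) (s : ℝ) :
    Tendsto (fun ε => ∫ x, f x * deriv (step s ε) x) (𝓝[>] 0) (𝓝 (f s)) := by
  have hcv : ∀ᶠ ε in 𝓝[>] (0 : ℝ), ∫ y, f (ε * y + s) * deriv Real.smoothTransition y
      = ∫ x, f x * deriv (step s ε) x := by
    filter_upwards [self_mem_nhdsWithin] with ε hε
    have hε0 : 0 < ε := hε
    have h1 := integral_sub_right_eq_self (μ := volume)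
      (fun z => f (z + s) * (deriv Real.smoothTransition (z / ε) * ε⁻¹)) s
    have h2 := Measure.integral_comp_mul_left
      (fun z => f (z + s) * (deriv Real.smoothTransition (z / ε) * ε⁻¹)) ε
    simp only [sub_add_cancel] at h1
    simp only [(hasDerivAt_step _ _ _).deriv]
    rw [h1]
    simp only [mul_div_cancel_left₀ _ hε0.ne', ← mul_assoc] at h2 ⊢
    rw [integral_mul_const, abs_of_pos (inv_pos.2 hε0), smul_eq_mul] at h2
    rw [mul_comm] at h2
    exact mul_left_cancel₀ (inv_pos.2 hε0).ne' h2
  refine Tendsto.congr' hcv ?_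
  have hlim : f s = ∫ y, f s * deriv Real.smoothTransition y := by
    rw [integral_const_mul, integral_deriv_smoothTransition, mul_one]
  rw [hlim]
  have hσ := continuous_deriv_smoothTransition
  refine tendsto_integral_filter_of_dominated_convergence
    (fun y => C * |deriv Real.smoothTransition y|) ?_ ?_ ?_ ?_
  · exact Eventually.of_forall fun ε => by fun_prop
  · refine Eventually.of_forall fun ε => Eventually.of_forall fun y => ?_
    rw [norm_mul, Real.norm_eq_abs, Real.norm_eq_abs]
    exact mul_le_mul_of_nonneg_right (hC _) (abs_nonneg _)
  · exact ((hσ.integrable_of_hasCompactSupport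
      hasCompactSupport_deriv_smoothTransition).abs).const_mul C
  · refine Eventually.of_forall fun y => Tendsto.mul_const _ ?_
    have : Continuous fun ε => f (ε * y + s) := by fun_prop
    simpa using (this.tendsto 0).mono_left nhdsWithin_le_nhds

theorem step_sub_step_eq_zero {s t ε x : ℝ} (hst : s ≤ t) (hε : 0 < ε)
    (hx : x ∉ Icc s (t + ε)) : step s ε x - step t ε x = 0 := by
  rw [mem_Icc, not_and_or, not_le, not_le] at hx
  unfold step
  rcases hx with hx | hx
  · rw [Real.smoothTransition.zero_of_nonpos, Real.smoothTransition.zero_of_nonpos, sub_zero] <;>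
    exact div_nonpos_of_nonpos_of_nonneg (by linarith) hε.le
  · rw [Real.smoothTransition.one_of_one_le, Real.smoothTransition.one_of_one_le, sub_self] <;>
    exact (one_le_div hε).2 (by linarith)

theorem isTest_step_sub_step {s t ε : ℝ} (hs : 0 < s) (hst : s ≤ t) (hε : 0 < ε)
    (ht : t + ε < 1) : IsTest fun x => step s ε x - step t ε x where
  smooth := by
    have := contDiff_smoothTransition
    unfold step
    fun_prop
  compactSupport :=
    HasCompactSupport.intro isCompact_Icc fun _ hx => step_sub_step_eq_zero hst hε hx
  support_subset := by
    refine (closure_minimal (fun x hx => ?_) isClosed_Icc).trans (Icc_subset_Ioo hs ht)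
    by_contra hx'
    exact hx (step_sub_step_eq_zero hst hε hx')

theorem abs_step_sub_step_le (s t ε x : ℝ) : |step s ε x - step t ε x| ≤ 1 := by
  have h1 := Real.smoothTransition.nonneg ((x - s) / ε)
  have h2 := Real.smoothTransition.le_one ((x - s) / ε)
  have h3 := Real.smoothTransition.nonneg ((x - t) / ε)
  have h4 := Real.smoothTransition.le_one ((x - t) / ε)
  unfold step
  rw [abs_le]
  constructor <;> linarith

/-- The fundamental theorem of calculus for weak derivatives, between interior points. -/
theorem IsWeakDeriv.sub_eq_integral {u g f : ℝ → ℝ} (h : IsWeakDeriv u g)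
    (hg : IntegrableOn g (Ioo 0 1)) (hf : ContinuousOn f (Icc 0 1)) (hfu : f =ᵐ[unitMeasure] u)
    {s t : ℝ} (hs : 0 < s) (hst : s ≤ t) (ht : t < 1) :
    f t - f s = ∫ x in s..t, g x := by
  -- The constant extension is bounded and continuous on the whole line. The test functions,
  -- differences of steps at s and t, then produce k(s) - k(t) on one side and the integral of g
  -- over (s, t] on the other.
  obtain ⟨k, hk⟩ : ∃ k, k = IccExtend zero_le_one ((Icc (0 : ℝ) 1).domRestrict f) := ⟨_, rfl⟩
  have hkc : Continuous k := hk ▸ hf.domRestrict.Icc_extend'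
  have hkf : ∀ x ∈ Icc (0 : ℝ) 1, k x = f x := fun x hx => by
    rw [hk, IccExtend_of_mem _ _ hx, domRestrict_apply]
  obtain ⟨C, hC⟩ : ∃ C, ∀ x, |k x| ≤ C := by
    obtain ⟨C, hC⟩ := isCompact_Icc.exists_bound_of_continuousOn hf
    refine ⟨C, fun x => ?_⟩
    rw [hk]
    exact hC _ (projIcc 0 1 zero_le_one x).2
  have e1 : ∀ᶠ ε in 𝓝[>] (0 : ℝ),
      (∫ x, k x * deriv (step s ε) x) - ∫ x, k x * deriv (step t ε) x
        = -∫ x in Ioo (0 : ℝ) 1, g x * (step s ε x - step t ε x) := by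
    filter_upwards [Ioo_mem_nhdsGT (sub_pos.2 ht)] with ε hε
    have hT := isTest_step_sub_step hs hst hε.1 (by linarith [hε.2])
    have hd : ∀ p x, deriv (step p ε) x = deriv Real.smoothTransition ((x - p) / ε) * ε⁻¹ :=
      fun p x => (hasDerivAt_step p ε x).deriv
    have hi : ∀ p, Integrable fun x => k x * deriv (step p ε) x := by
      intro p
      have hσ := continuous_deriv_smoothTransition
      have : Continuous fun x => k x * deriv (step p ε) x := by
        simp only [hd]
        fun_prop
      refine this.integrable_of_hasCompactSupport (HasCompactSupport.mul_left ?_)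
      refine HasCompactSupport.intro (isCompact_Icc (a := p) (b := p + ε)) fun x hx => ?_
      rw [hd]
      have : deriv Real.smoothTransition ((x - p) / ε) = 0 := by
        rw [mem_Icc, not_and_or, not_le, not_le] at hx
        rcases hx with hx | hx
        · have : Real.smoothTransition =ᶠ[𝓝 ((x - p) / ε)] fun _ => 0 := by
            filter_upwards [Iio_mem_nhds (div_neg_of_neg_of_pos (sub_neg.2 hx) hε.1)] with y hy
            exact Real.smoothTransition.zero_of_nonpos (le_of_lt hy)
          rw [this.deriv_eq, deriv_const]
        · have : Real.smoothTransition =ᶠ[𝓝 ((x - p) / ε)] fun _ => 1 := by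
            filter_upwards [Ioi_mem_nhds ((one_lt_div hε.1).2 (lt_sub_iff_add_lt'.2 hx))] with y hy
            exact Real.smoothTransition.one_of_one_le (le_of_lt hy)
          rw [this.deriv_eq, deriv_const]
      rw [this, zero_mul]
    rw [← h _ hT, ← integral_sub (hi s) (hi t)]
    have hderiv : ∀ x, deriv (fun x => step s ε x - step t ε x) x
        = deriv (step s ε) x - deriv (step t ε) x := fun x =>
      deriv_fun_sub (hasDerivAt_step s ε x).differentiableAt
        (hasDerivAt_step t ε x).differentiableAt
    rw [← setIntegral_eq_integral_of_forall_compl_eq_zero (s := Ioo (0 : ℝ) 1)]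
    · refine integral_congr_ae ?_
      filter_upwards [hfu, ae_restrict_mem measurableSet_Ioo] with x hx hx'
      rw [hderiv, ← hx, hkf x (Ioo_subset_Icc_self hx'), mul_sub]
    · intro x hx
      rw [← mul_sub, ← hderiv]
      have : x ∉ tsupport (deriv fun x => step s ε x - step t ε x) := fun hx' =>
        hx (hT.support_subset (tsupport_deriv_subset hx'))
      rw [image_eq_zero_of_notMem_tsupport this, mul_zero]
  have l1 := ((tendsto_integral_mul_deriv_step hkc hC s).sub
    (tendsto_integral_mul_deriv_step hkc hC t)).congr' e1
  have l2 : Tendsto (fun ε => -∫ x in Ioo (0 : ℝ) 1, g x * (step s ε x - step t ε x)) (𝓝[>] 0)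
      (𝓝 (-∫ x in s..t, g x)) := by
    have hlim : ∫ x in s..t, g x = ∫ x in Ioo (0 : ℝ) 1,
        g x * ((Ioi s).indicator 1 x - (Ioi t).indicator 1 x) := by
      have : ∀ x, g x * ((Ioi s).indicator 1 x - (Ioi t).indicator 1 x)
          = (Ioc s t).indicator g x := by
        intro x
        by_cases h1 : s < x <;> by_cases h2 : t < x
        · simp [indicator, h1, h2, not_le.2 h2]
        · simp [indicator, h1, h2, not_lt.1 h2]
        · exact absurd (hst.trans_lt h2) h1
        · simp [indicator, h1, h2]
      simp only [this]
      rw [intervalIntegral.integral_of_le hst, setIntegral_indicator measurableSet_Ioc,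
        inter_eq_self_of_subset_right ((Ioc_subset_Icc_self).trans (Icc_subset_Ioo hs ht))]
    rw [hlim]
    refine Tendsto.neg (tendsto_integral_filter_of_dominated_convergence (fun x => |g x|)
      ?_ ?_ hg.abs ?_)
    · refine Eventually.of_forall fun ε => hg.aestronglyMeasurable.mul ?_
      have := contDiff_smoothTransition.continuous
      unfold step
      fun_prop
    · refine Eventually.of_forall fun ε => Eventually.of_forall fun x => ?_
      rw [norm_mul, Real.norm_eq_abs, Real.norm_eq_abs]
      exact mul_le_of_le_one_right (abs_nonneg _) (abs_step_sub_step_le _ _ _ _)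
    · exact Eventually.of_forall fun x => (tendsto_step.sub tendsto_step).const_mul _
  have := tendsto_nhds_unique l1 l2
  rw [hkf s ⟨hs.le, hst.trans ht.le⟩, hkf t ⟨hs.le.trans hst, ht.le⟩] at this
  linarith

theorem IsWeakDeriv.eq_integral {u g f : ℝ → ℝ} (h : IsWeakDeriv u g)
    (hg : IntegrableOn g (Ioo 0 1)) (hf : ContinuousOn f (Icc 0 1)) (hfu : f =ᵐ[unitMeasure] u)
    (hf0 : f 0 = 0) {t : ℝ} (ht : t ∈ Ioo (0 : ℝ) 1) :
    f t = ∫ x in 0..t, g x := by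
  have hgi : IntervalIntegrable g volume 0 t := by
    rw [intervalIntegrable_iff_integrableOn_Ioo_of_le ht.1.le]
    exact hg.mono_set (Ioo_subset_Ioo le_rfl ht.2.le)
  have h1 : Tendsto (fun s => f t - f s) (𝓝[>] 0) (𝓝 (f t - 0)) := by
    refine tendsto_const_nhds.sub ?_
    have := (hf 0 (by simp)).tendsto
    rw [hf0] at this
    exact this.mono_left (nhdsWithin_le_of_mem (mem_of_superset (Ioo_mem_nhdsGT one_pos)
      Ioo_subset_Icc_self))
  have h2 : Tendsto (fun s => (∫ x in 0..t, g x) - ∫ x in 0..s, g x) (𝓝[>] 0)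
      (𝓝 ((∫ x in 0..t, g x) - 0)) := by
    refine tendsto_const_nhds.sub ?_
    have := (intervalIntegral.continuousOn_primitive_interval' hgi left_mem_uIcc) 0 left_mem_uIcc
    have := this.tendsto
    rw [intervalIntegral.integral_same, uIcc_of_le ht.1.le] at this
    exact this.mono_left (nhdsWithin_le_of_mem (mem_of_superset (Ioo_mem_nhdsGT ht.1)
      Ioo_subset_Icc_self))
  have e : ∀ᶠ s in 𝓝[>] (0 : ℝ), (∫ x in 0..t, g x) - (∫ x in 0..s, g x) = f t - f s := by
    filter_upwards [Ioo_mem_nhdsGT ht.1] with s hs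
    rw [h.sub_eq_integral hg hf hfu hs.1 hs.2.le ht.2,
      intervalIntegral.integral_interval_sub_left hgi]
    exact hgi.mono_set (by
      rw [uIcc_of_le hs.1.le, uIcc_of_le ht.1.le]
      exact Icc_subset_Icc_right hs.2.le)
  have := tendsto_nhds_unique h1 (h2.congr' e)
  linarith

/-! ### The uniform bound for γ ≤ 1. -/

theorem abs_intervalIntegral_pow_le {g : ℝ → ℝ} {N : ℕ} (hN : 1 ≤ N) {s t : ℝ} (hst : s ≤ t)
    (hg : IntervalIntegrable g volume s t)
    (hgN : IntervalIntegrable (fun x => |g x| ^ N) volume s t) :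
    |∫ x in s..t, g x| ^ N ≤ (t - s) ^ (N - 1) * ∫ x in s..t, |g x| ^ N := by
  rcases hst.eq_or_lt with rfl | hlt
  · simp [show N ≠ 0 by omega]
  have h0 : 0 < t - s := sub_pos.2 hlt
  have hJ := (convexOn_pow (𝕜 := ℝ) N).map_set_average_le (μ := volume) (t := Ioc s t)
    (f := fun x => |g x|) (continuousOn_pow N) isClosed_Ici (by simp [hlt]) (by simp)
    (Eventually.of_forall fun x => abs_nonneg (g x))
    ((intervalIntegrable_iff_integrableOn_Ioc_of_le hst).1 hg).abs
    ((intervalIntegrable_iff_integrableOn_Ioc_of_le hst).1 hgN)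
  simp only [setAverage_eq, ← intervalIntegral.integral_of_le hst, smul_eq_mul,
    Real.volume_real_Ioc_of_le hst] at hJ
  calc |∫ x in s..t, g x| ^ N ≤ (∫ x in s..t, |g x|) ^ N := by
        gcongr
        exact intervalIntegral.abs_integral_le_integral_abs hst
    _ = (t - s) ^ N * ((t - s)⁻¹ * ∫ x in s..t, |g x|) ^ N := by
        rw [← mul_pow, mul_inv_cancel_left₀ h0.ne']
    _ ≤ (t - s) ^ N * ((t - s)⁻¹ * ∫ x in s..t, |g x| ^ N) := by gcongr
    _ = _ := by
        obtain ⟨m, rfl⟩ : ∃ m, N = m + 1 := ⟨N - 1, by omega⟩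
        rw [Nat.add_sub_cancel, pow_succ]
        field_simp

/-- Reduces γ ≤ 1 and a signed quotient q (possible for odd N) to the critical weight. Trouble
arises only if X + γY < 0, where X = log(e/s) and Y = log X; since X ≥ Y²/2, this forces Y ≤ -2γ, so
the exponent is at most 2γ². -/
theorem exp_mul_le_of_abs_le {γ s q h : ℝ} (hγ : γ ≤ 1) (hs : 0 < s) (hs1 : s ≤ 1)
    (hqh : |q| ≤ h) (hh : h ≤ 1) :
    Real.exp ((Real.log (Real.exp 1 / s) + γ * Real.log (Real.log (Real.exp 1 / s))) * q) ≤
      Real.exp (weight s * h) + Real.exp (2 * γ ^ 2) := by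
  have hL := one_le_log_exp_one_div hs hs1
  have hW := weight_nonneg hs hs1
  unfold weight at hW ⊢
  obtain ⟨X, hX⟩ : ∃ X, X = Real.log (Real.exp 1 / s) := ⟨_, rfl⟩
  obtain ⟨Y, hY⟩ : ∃ Y, Y = Real.log X := ⟨_, rfl⟩
  rw [← hX] at hL hW ⊢
  rw [← hY] at hW ⊢
  have hY0 : 0 ≤ Y := hY ▸ Real.log_nonneg hL
  have hXY : Y ^ 2 / 2 ≤ X := by
    have := Real.quadratic_le_exp_of_nonneg hY0
    rw [hY, Real.exp_log (by linarith), ← hY] at this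
    linarith
  have hh0 := (abs_nonneg q).trans hqh
  rcases le_total 0 (X + γ * Y) with h0 | h0
  · refine le_add_of_le_of_nonneg (Real.exp_le_exp.2 ?_) (Real.exp_pos _).le
    calc (X + γ * Y) * q ≤ (X + γ * Y) * h := by
          gcongr
          exact (le_abs_self q).trans hqh
      _ ≤ (X + Y) * h := by
          gcongr
          nlinarith
  · refine le_add_of_nonneg_of_le (Real.exp_pos _).le (Real.exp_le_exp.2 ?_)
    have hYγ : Y ≤ 2 * -γ := by nlinarith
    have hq : -q ≤ 1 := (neg_le_abs q).trans (hqh.trans hh)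
    have hγ0 : γ ≤ 0 := by nlinarith
    calc (X + γ * Y) * q = -(X + γ * Y) * -q := by ring
      _ ≤ -(X + γ * Y) * 1 := by
          refine mul_le_mul_of_nonneg_left hq (by linarith)
      _ ≤ -γ * Y := by linarith
      _ ≤ -γ * (2 * -γ) := by
          refine mul_le_mul_of_nonneg_left hYγ (by linarith)
      _ = _ := by ring

/-- The point of the bound is that its right side does not involve v: the location of concentration
has dropped out. -/
theorem J_rep_le {N : ℕ} [hN : Fact (2 ≤ N)] {γ : ℝ} (hγ : γ ≤ 1) {v : W1 N} (hv : v ∈ E N) :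
    J N γ (rep v) ≤ ENNReal.ofReal (16 * Real.exp 1 / (1 / 4) ^ N) +
      (∫⁻ s in Ioo (0 : ℝ) 1, ENNReal.ofReal (Real.exp ((1 - (1 / 4) ^ N / 2) * weight s)))
      + ENNReal.ofReal (Real.exp (2 * γ ^ 2)) := by
  obtain ⟨⟨f, hfc, hfr, hf0⟩, hE⟩ := hv
  have hN2 : 2 ≤ N := hN.out
  obtain ⟨g, hg⟩ : ∃ g, g = weakDeriv v := ⟨_, rfl⟩
  have hgL : MemLp g N unitMeasure := hg ▸ Lp.memLp _
  have hgi : IntegrableOn g (Ioo 0 1) := hgL.integrable Fact.out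
  have hgN : IntegrableOn (fun x => |g x| ^ N) (Ioo 0 1) := hgL.integrable_norm_pow (by omega)
  rw [← hg] at hE
  have hw : IsWeakDeriv (rep v) g := hg ▸ v.2
  have ii : ∀ {k : ℝ → ℝ}, IntegrableOn k (Ioo 0 1) → IntervalIntegrable k volume 0 1 :=
    fun hk => (intervalIntegrable_iff_integrableOn_Ioo_of_le zero_le_one).2 hk
  have sub : ∀ {k : ℝ → ℝ}, IntegrableOn k (Ioo 0 1) → ∀ s ∈ Icc (0 : ℝ) 1,
      ∀ t ∈ Icc (0 : ℝ) 1, IntervalIntegrable k volume s t := fun hk s hs t ht =>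
    (ii hk).mono_set (by rw [uIcc_of_le (zero_le_one' ℝ)]; exact uIcc_subset_Icc hs ht)
  have m0 : (0 : ℝ) ∈ Icc (0 : ℝ) 1 := by simp
  obtain ⟨F, hF⟩ : ∃ F : ℝ → ℝ, F = fun t => ∫ x in 0..t, g x := ⟨_, rfl⟩
  obtain ⟨M, hM⟩ : ∃ M : ℝ → ℝ, M = fun t => ∫ x in 0..t, |g x| ^ N := ⟨_, rfl⟩
  have cont : ∀ {k : ℝ → ℝ}, IntegrableOn k (Ioo 0 1) →
      ContinuousOn (fun t => ∫ x in 0..t, k x) (Icc 0 1) := fun hk => by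
    have := intervalIntegral.continuousOn_primitive_interval' (ii hk) left_mem_uIcc
    rwa [uIcc_of_le zero_le_one] at this
  have hMsub : ∀ s ∈ Icc (0 : ℝ) 1, ∀ t ∈ Icc (0 : ℝ) 1, M t - M s = ∫ x in s..t, |g x| ^ N := by
    intro s hs t ht
    rw [hM]
    exact intervalIntegral.integral_interval_sub_left (sub hgN 0 m0 t ht) (sub hgN 0 m0 s hs)
  obtain ⟨a, ha0, ha1, ha⟩ := exists_concentration_point hN2 (f := F) (M := M) (hF ▸ cont hgi)
    (by simp [hF]) (hM ▸ cont hgN) (by simp [hM])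
    (by rw [hM]; dsimp only; rw [intervalIntegral.integral_of_le zero_le_one,
          integral_Ioc_eq_integral_Ioo, hE])
    (fun s hs t ht hst => sub_nonneg.1 (by
      rw [hMsub s hs t ht]
      exact intervalIntegral.integral_nonneg hst fun x _ => by positivity))
    (fun s hs t ht hst => by
      rw [hMsub s hs t ht, hF]
      dsimp only
      rw [intervalIntegral.integral_interval_sub_left (sub hgi 0 m0 t ht) (sub hgi 0 m0 s hs)]
      exact abs_intervalIntegral_pow_le (by omega) hst (sub hgi s hs t ht) (sub hgN s hs t ht))
  refine le_trans ?_ (add_le_add_left (lintegral_exp_weight_mul_le (by positivity) ha0 ha1 ha) _)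
  have hone : ENNReal.ofReal (Real.exp (2 * γ ^ 2))
      = ∫⁻ _ in Ioo (0 : ℝ) 1, ENNReal.ofReal (Real.exp (2 * γ ^ 2)) := by simp
  rw [hone, ← lintegral_add_right _ measurable_const, J]
  refine lintegral_mono_ae ?_
  filter_upwards [hfr, ae_restrict_mem measurableSet_Ioo] with s hs hs'
  rw [← ENNReal.ofReal_add (by positivity) (by positivity)]
  refine ENNReal.ofReal_le_ofReal (exp_mul_le_of_abs_le hγ hs'.1 hs'.2.le ?_ ?_)
  · rw [← hs, hw.eq_integral hgi hfc hfr hf0 hs', hF, abs_div, abs_pow,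
      abs_of_pos (pow_pos hs'.1 _)]
  · refine (ha s hs').trans (sub_le_self _ (mul_nonneg (by positivity) ?_))
    rw [sub_nonneg, Real.exp_le_one_iff]
    simp

theorem iSup_J_lt_top {N : ℕ} [Fact (2 ≤ N)] {γ : ℝ} (hγ : γ ≤ 1) :
    (⨆ v ∈ E N, J N γ (rep v)) < ⊤ := by
  have h4 : (1 / 4 : ℝ) ^ N ≤ 1 := pow_le_one₀ (by norm_num) (by norm_num)
  have h4' : (0 : ℝ) < (1 / 4) ^ N := by positivity
  refine lt_of_le_of_lt (iSup₂_le fun v hv => J_rep_le hγ hv) ?_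
  rw [ENNReal.add_lt_top, ENNReal.add_lt_top]
  exact ⟨⟨ENNReal.ofReal_lt_top, lintegral_exp_mul_weight_lt_top (by linarith) (by linarith)⟩,
    ENNReal.ofReal_lt_top⟩

/-! ### The Moser functions as elements of the constraint set. -/

theorem moser_eq {N : ℕ} (hN : 2 ≤ N) (j : ℕ) (t : ℝ) :
    moser N j t = (j : ℝ) ^ (1 / (N : ℝ)) * min t (1 / (j : ℝ)) := by
  have hN' : (2 : ℝ) ≤ N := by exact_mod_cast hN
  unfold moser
  split_ifs with h
  · rw [min_eq_left h]
  · rw [min_eq_right (le_of_not_ge h)]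
    -- For j = 0 the conventions for division by zero and powers of zero make both sides 0, so the
    -- family may be indexed by all naturals.
    rcases Nat.eq_zero_or_pos j with rfl | hj
    · have h1 : ((N : ℝ) - 1) / N ≠ 0 := div_ne_zero (by linarith) (by linarith)
      simp [Real.zero_rpow h1]
    · have hj' : (0 : ℝ) < j := by exact_mod_cast hj
      have : ((N : ℝ) - 1) / N = 1 - 1 / N := by field_simp
      rw [this, Real.rpow_sub hj', Real.rpow_one, one_div_div, div_eq_mul_one_div]

/-- The derivative of the Moser function. -/
noncomputable def moserDeriv (N j : ℕ) (t : ℝ) : ℝ :=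
  (Iio (1 / (j : ℝ))).indicator (fun _ => (j : ℝ) ^ (1 / (N : ℝ))) t

theorem isWeakDeriv_const_mul_min (c b : ℝ) :
    IsWeakDeriv (fun t => c * min t b) ((Iio b).indicator fun _ => c) := by
  intro φ hφ
  have h0 : φ 0 = 0 := image_eq_zero_of_notMem_tsupport fun h =>
    lt_irrefl _ (hφ.support_subset h).1
  have h1 : φ 1 = 0 := image_eq_zero_of_notMem_tsupport fun h =>
    lt_irrefl _ (hφ.support_subset h).2
  have := intervalIntegral.integral_mul_deriv_eq_deriv_mul_of_hasDeriv_right (a := 0) (b := 1)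
    (u := fun t => c * min t b) (u' := (Iio b).indicator fun _ => c) (v := φ) (v' := deriv φ)
    (by fun_prop) hφ.smooth.continuous.continuousOn
    (fun x _ => ?_)
    (fun x _ => ((hφ.smooth.differentiable (by simp)) x).hasDerivAt.hasDerivWithinAt)
    ?_ (hφ.continuous_deriv.intervalIntegrable _ _)
  · rw [← integral_Ioc_eq_integral_Ioo, ← integral_Ioc_eq_integral_Ioo,
      ← intervalIntegral.integral_of_le zero_le_one,
      ← intervalIntegral.integral_of_le zero_le_one, this, h0, h1]
    simp
  -- Integration by parts needs only right derivatives, so the kink is harmless: at x = b the right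
  -- derivative is 0, in agreement with the open half-line.
  · by_cases hx : x < b
    · rw [indicator_of_mem (mem_Iio.2 hx)]
      have : HasDerivAt (fun t : ℝ => c * t) c x := by simpa using (hasDerivAt_id x).const_mul c
      refine (this.congr_of_eventuallyEq ?_).hasDerivWithinAt
      filter_upwards [Iio_mem_nhds hx] with y hy
      rw [min_eq_left (le_of_lt hy)]
    · rw [indicator_of_notMem (by simpa using hx)]
      refine (hasDerivWithinAt_const x _ (c * b)).congr (fun y hy => ?_) ?_
      · rw [min_eq_right ((le_of_not_gt hx).trans (le_of_lt hy))]
      · rw [min_eq_right (le_of_not_gt hx)]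
  · rw [intervalIntegrable_iff]
    exact (integrableOn_const (by simp)).indicator measurableSet_Iio

theorem memLp_moserDeriv (N j : ℕ) : MemLp (moserDeriv N j) N unitMeasure :=
  (memLp_const _).indicator measurableSet_Iio

theorem abs_moser_le {N : ℕ} (hN : 2 ≤ N) (j : ℕ) {t : ℝ} (ht : t ∈ Ioo (0 : ℝ) 1) :
    |moser N j t| ≤ (j : ℝ) ^ (1 / (N : ℝ)) * (1 / (j : ℝ)) := by
  have := ht.1
  rw [moser_eq hN, abs_of_nonneg (by positivity)]
  gcongr
  exact min_le_right _ _

theorem continuous_moser {N : ℕ} (hN : 2 ≤ N) (j : ℕ) : Continuous (moser N j) := by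
  have : moser N j = fun t => (j : ℝ) ^ (1 / (N : ℝ)) * min t (1 / (j : ℝ)) :=
    funext (moser_eq hN j)
  rw [this]
  fun_prop

theorem memLp_moser {N : ℕ} (hN : 2 ≤ N) (j : ℕ) : MemLp (moser N j) N unitMeasure := by
  refine MemLp.of_bound (continuous_moser hN j).aestronglyMeasurable
    ((j : ℝ) ^ (1 / (N : ℝ)) * (1 / (j : ℝ))) ?_
  filter_upwards [ae_restrict_mem measurableSet_Ioo] with t ht using abs_moser_le hN j ht

/-- The Moser functions as elements of the Sobolev space. -/
noncomputable def moserW1 (N : ℕ) [hN : Fact (2 ≤ N)] (j : ℕ) : W1 N :=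
  ⟨WithLp.toLp _ ((memLp_moser hN.out j).toLp, (memLp_moserDeriv N j).toLp), by
    have hw : IsWeakDeriv (moser N j) (moserDeriv N j) := by
      have h := isWeakDeriv_const_mul_min ((j : ℝ) ^ (1 / (N : ℝ))) (1 / (j : ℝ))
      rwa [← funext (moser_eq hN.out j)] at h
    intro φ hφ
    refine Eq.trans (integral_congr_ae ?_) ((hw φ hφ).trans (congrArg _ (integral_congr_ae ?_)))
    · filter_upwards [(memLp_moser hN.out j).coeFn_toLp] with x hx using by rw [← hx]; rfl
    · filter_upwards [(memLp_moserDeriv N j).coeFn_toLp] with x hx using by rw [← hx]; rfl⟩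

theorem rep_moserW1 (N : ℕ) [hN : Fact (2 ≤ N)] (j : ℕ) :
    rep (moserW1 N j) =ᵐ[unitMeasure] moser N j :=
  (memLp_moser hN.out j).coeFn_toLp

theorem weakDeriv_moserW1 (N : ℕ) [Fact (2 ≤ N)] (j : ℕ) :
    weakDeriv (moserW1 N j) =ᵐ[unitMeasure] moserDeriv N j :=
  (memLp_moserDeriv N j).coeFn_toLp

theorem setIntegral_Ioo_indicator_Iio {b c : ℝ} (hb : 0 ≤ b) (hb1 : b ≤ 1) :
    ∫ x in Ioo (0 : ℝ) 1, (Iio b).indicator (fun _ => c) x = b * c := by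
  rw [setIntegral_indicator measurableSet_Iio, Ioo_inter_Iio, min_eq_right hb1,
    setIntegral_const, smul_eq_mul, Real.volume_real_Ioo_of_le hb, sub_zero]

theorem moserW1_mem_E (N : ℕ) [hN : Fact (2 ≤ N)] {j : ℕ} (hj : 1 ≤ j) :
    moserW1 N j ∈ E N := by
  have hN2 := hN.out
  have hj1 : (1 : ℝ) ≤ j := by exact_mod_cast hj
  refine ⟨⟨moser N j, (continuous_moser hN2 j).continuousOn, (rep_moserW1 N j).symm, ?_⟩, ?_⟩
  · rw [moser_eq hN2, min_eq_left (by positivity), mul_zero]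
  · calc ∫ x in Ioo (0 : ℝ) 1, |weakDeriv (moserW1 N j) x| ^ N
        = ∫ x in Ioo (0 : ℝ) 1, (Iio (1 / (j : ℝ))).indicator (fun _ => (j : ℝ)) x := by
          refine integral_congr_ae ?_
          filter_upwards [weakDeriv_moserW1 N j] with x hx
          rw [hx, moserDeriv]
          by_cases h : x ∈ Iio (1 / (j : ℝ))
          · rw [indicator_of_mem h, indicator_of_mem h, abs_of_nonneg (by positivity), one_div,
              Real.rpow_inv_natCast_pow (by positivity) (by omega)]
          · rw [indicator_of_notMem h, indicator_of_notMem h, abs_zero, zero_pow (by omega)]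
      _ = 1 := by
          rw [setIntegral_Ioo_indicator_Iio (by positivity)
            ((div_le_one (by positivity)).2 hj1)]
          field_simp

/-! ### Weak convergence of the Moser functions. -/

theorem Lp_norm_pow_eq {N : ℕ} [hN : Fact (2 ≤ N)] (f : Lp ℝ (N : ℝ≥0∞) unitMeasure) :
    ‖f‖ ^ N = ∫ x in Ioo (0 : ℝ) 1, |f x| ^ N := by
  have hN0 : N ≠ 0 := by have := hN.out; omega
  have h0 : 0 ≤ ∫ x in Ioo (0 : ℝ) 1, |f x| ^ N := integral_nonneg fun x => by positivity
  rw [Lp.norm_def, (Lp.memLp f).eLpNorm_eq_integral_rpow_norm (by exact_mod_cast hN0)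
    (ENNReal.natCast_ne_top N)]
  simp only [ENNReal.toReal_natCast, Real.rpow_natCast, Real.norm_eq_abs]
  rw [ENNReal.toReal_ofReal (by positivity), Real.rpow_inv_natCast_pow h0 hN0]

theorem tendsto_natCast_rpow_one_div_atTop {N : ℕ} (hN : 1 ≤ N) :
    Tendsto (fun j : ℕ => (j : ℝ) ^ (1 / (N : ℝ))) atTop atTop :=
  (tendsto_rpow_atTop (by positivity)).comp tendsto_natCast_atTop_atTop

/-- Concentrating normalised bumps can be superposed at the cost of a bounded increase of the
`N`-th power of the norm. -/
theorem exists_superposition {N : ℕ} [hN : Fact (2 ≤ N)]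
    (b : Lp ℝ (N : ℝ≥0∞) unitMeasure →L[ℝ] ℝ) {ε : ℝ}
    (hε : ∃ᶠ j : ℕ in atTop, ε ≤ b (memLp_moserDeriv N j).toLp) (K : ℕ) :
    ∃ (f : Lp ℝ (N : ℝ≥0∞) unitMeasure) (C : ℝ), (∀ᵐ x ∂unitMeasure, |f x| ≤ C) ∧
      ‖f‖ ^ N ≤ 2 ^ N * K ∧ K * ε ≤ b f := by
  have hN2 := hN.out
  induction K with
  | zero =>
    refine ⟨0, 0, ?_, by simp [show N ≠ 0 by omega], by simp⟩
    filter_upwards [Lp.coeFn_zero ℝ (N : ℝ≥0∞) unitMeasure] with x hx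
    exact (congrArg abs hx).trans_le (by simp)
  | succ K ih =>
    obtain ⟨f, C, hC, hf, hb⟩ := ih
    -- The new bump is taken at least as high as the bound C for f. On its support, of length 1/j,
    -- the sum is at most twice the height j^(1/N), so the N-th power of the norm grows by at most
    -- 2^N.
    obtain ⟨j, hj, hjC, hj1⟩ := (hε.and_eventually
      (((tendsto_natCast_rpow_one_div_atTop (N := N) (by omega)).eventually_ge_atTop C).and
        (eventually_ge_atTop 1))).exists
    have hj1' : (1 : ℝ) ≤ j := by exact_mod_cast hj1
    obtain ⟨c, hc⟩ : ∃ c, c = (j : ℝ) ^ (1 / (N : ℝ)) := ⟨_, rfl⟩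
    have hc0 : 0 ≤ c := by rw [hc]; positivity
    have hcN : c ^ N = j := by
      rw [hc, one_div, Real.rpow_inv_natCast_pow (by positivity) (by omega)]
    rw [← hc] at hjC
    have hadd := Lp.coeFn_add f (memLp_moserDeriv N j).toLp
    have hmo := (memLp_moserDeriv N j).coeFn_toLp
    refine ⟨f + (memLp_moserDeriv N j).toLp, C + c, ?_, ?_, ?_⟩
    · filter_upwards [hadd, hmo, hC] with x hx hm hCx
      rw [hx, Pi.add_apply, hm]
      refine (abs_add_le _ _).trans (add_le_add hCx ?_)
      rw [moserDeriv, ← hc]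
      by_cases h : x ∈ Iio (1 / (j : ℝ))
      · rw [indicator_of_mem h, abs_of_nonneg hc0]
      · rwa [indicator_of_notMem h, abs_zero]
    · have hfi : Integrable (fun x => |f x| ^ N) unitMeasure :=
        (Lp.memLp f).integrable_norm_pow (by omega)
      have hfi' : Integrable (fun x => |(f + (memLp_moserDeriv N j).toLp : Lp ℝ _ _) x| ^ N)
          unitMeasure := (Lp.memLp (f + (memLp_moserDeriv N j).toLp)).integrable_norm_pow (by omega)
      have hind : Integrable ((Iio (1 / (j : ℝ))).indicator fun _ => 2 ^ N * (j : ℝ))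
          unitMeasure := (integrable_const _).indicator measurableSet_Iio
      calc ‖f + (memLp_moserDeriv N j).toLp‖ ^ N
          = ∫ x in Ioo (0 : ℝ) 1, |(f + (memLp_moserDeriv N j).toLp : Lp ℝ _ _) x| ^ N :=
            Lp_norm_pow_eq _
        _ ≤ ∫ x in Ioo (0 : ℝ) 1, (|f x| ^ N +
              (Iio (1 / (j : ℝ))).indicator (fun _ => 2 ^ N * (j : ℝ)) x) := by
            refine integral_mono_ae hfi'
              (hfi.add hind) ?_
            filter_upwards [hadd, hmo, hC] with x hx hm hCx
            rw [hx, Pi.add_apply, hm, moserDeriv, ← hc]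
            by_cases h : x ∈ Iio (1 / (j : ℝ))
            · rw [indicator_of_mem h, indicator_of_mem h, ← hcN, ← mul_pow]
              refine le_add_of_nonneg_of_le (by positivity) ?_
              gcongr
              calc |f x + c| ≤ |f x| + |c| := abs_add_le _ _
                _ ≤ 2 * c := by rw [abs_of_nonneg hc0]; linarith
            · rw [indicator_of_notMem h, indicator_of_notMem h, add_zero, add_zero]
        _ = ‖f‖ ^ N + 2 ^ N := by
            rw [integral_add hfi hind, ← Lp_norm_pow_eq, setIntegral_Ioo_indicator_Iio
              (by positivity) ((div_le_one (by positivity)).2 hj1')]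
            field_simp
        _ ≤ 2 ^ N * (K + 1 : ℕ) := by push_cast; linarith
    · rw [map_add]
      push_cast
      linarith

/-- Superposing K bumps would give (Kε)^N ≤ ‖b‖^N 2^N K. As N ≥ 2 and K ≥ 1, this bounds K by
(2‖b‖/ε)^N, although K is arbitrary. -/
theorem not_frequently_le_apply_moserDeriv {N : ℕ} [hN : Fact (2 ≤ N)]
    (b : Lp ℝ (N : ℝ≥0∞) unitMeasure →L[ℝ] ℝ) {ε : ℝ} (hε : 0 < ε) :
    ¬ ∃ᶠ j : ℕ in atTop, ε ≤ b (memLp_moserDeriv N j).toLp := by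
  intro hfreq
  have hN2 := hN.out
  obtain ⟨K, hK⟩ := exists_nat_gt (max 1 ((‖b‖ * 2 / ε) ^ N))
  obtain ⟨f, C, -, hf, hb⟩ := exists_superposition b hfreq K
  have hK1 : (1 : ℝ) < K := (le_max_left _ _).trans_lt hK
  have h1 : (K * ε) ^ N ≤ ‖b‖ ^ N * (2 ^ N * K) := by
    calc (K * ε) ^ N ≤ (‖b‖ * ‖f‖) ^ N := by
          exact pow_le_pow_left₀ (by positivity)
            (hb.trans ((le_abs_self _).trans (b.le_opNorm f))) N
      _ = ‖b‖ ^ N * ‖f‖ ^ N := mul_pow ..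
      _ ≤ _ := by gcongr
  have h2 : (K : ℝ) * K ≤ (K : ℝ) ^ N := by
    rw [← sq]
    exact pow_le_pow_right₀ hK1.le hN2
  have h3 : (K : ℝ) * (K * ε ^ N) ≤ K * (‖b‖ * 2) ^ N := by
    calc (K : ℝ) * (K * ε ^ N) = (K * K) * ε ^ N := by ring
      _ ≤ K ^ N * ε ^ N := by gcongr
      _ = (K * ε) ^ N := (mul_pow ..).symm
      _ ≤ _ := h1
      _ = _ := by rw [mul_pow]; ring
  have h4 : (K : ℝ) ≤ (‖b‖ * 2 / ε) ^ N := by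
    rw [div_pow, le_div_iff₀ (by positivity)]
    exact le_of_mul_le_mul_left h3 (by linarith)
  exact absurd ((le_max_right _ _).trans_lt hK) (not_lt.2 h4)

theorem tendsto_apply_moserDeriv {N : ℕ} [Fact (2 ≤ N)]
    (b : Lp ℝ (N : ℝ≥0∞) unitMeasure →L[ℝ] ℝ) :
    Tendsto (fun j : ℕ => b (memLp_moserDeriv N j).toLp) atTop (𝓝 0) := by
  rw [tendsto_order]
  refine ⟨fun ε hε => ?_, fun ε hε => ?_⟩
  · have := not_frequently_le_apply_moserDeriv (-b) (neg_pos.2 hε)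
    rw [not_frequently] at this
    filter_upwards [this] with j hj
    rw [neg_apply] at hj
    linarith
  · have := not_frequently_le_apply_moserDeriv b hε
    rw [not_frequently] at this
    filter_upwards [this] with j hj using not_le.1 hj

theorem tendsto_moser_toLp (N : ℕ) [hN : Fact (2 ≤ N)] :
    Tendsto (fun j : ℕ => (memLp_moser hN.out j).toLp) atTop (𝓝 0) := by
  have hN2 := hN.out
  rw [tendsto_zero_iff_norm_tendsto_zero]
  have hlim : Tendsto (fun j : ℕ => (j : ℝ) ^ (1 / (N : ℝ)) * (1 / (j : ℝ))) atTop (𝓝 0) := by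
    have hN' : (2 : ℝ) ≤ N := by exact_mod_cast hN2
    have h1 : 0 < 1 - 1 / (N : ℝ) := by
      rw [sub_pos, div_lt_one (by linarith)]
      linarith
    refine ((tendsto_rpow_neg_atTop h1).comp tendsto_natCast_atTop_atTop).congr' ?_
    filter_upwards [eventually_ge_atTop 1] with j hj
    have hj0 : (0 : ℝ) < j := by exact_mod_cast hj
    rw [Function.comp_apply, neg_sub, Real.rpow_sub hj0, Real.rpow_one, div_eq_mul_one_div]
  refine squeeze_zero (fun _ => norm_nonneg _) (fun j => ?_)
    (by simpa only [mul_zero] using hlim.const_mul ((measureUnivNNReal unitMeasure : ℝ) ^ ((N : ℝ≥0∞).toReal⁻¹)))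
  refine Lp.norm_le_of_ae_bound (by positivity) ?_
  filter_upwards [(memLp_moser hN2 j).coeFn_toLp, ae_restrict_mem measurableSet_Ioo] with x hx hx'
  rw [hx]
  exact abs_moser_le hN2 j hx'

/-- By Hahn–Banach a functional on the Sobolev space extends to the product of two copies of L^N and
splits into a part acting on functions, which converge in norm, and a part acting on derivatives. -/
theorem tendsto_toWeakSpace_moserW1 (N : ℕ) [hN : Fact (2 ≤ N)] :
    Tendsto (fun j => toWeakSpace ℝ (W1 N) (moserW1 N j)) atTop
      (𝓝 (toWeakSpace ℝ (W1 N) 0)) := by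
  have hind : IsInducing fun (x : WeakSpace ℝ (W1 N)) (l : StrongDual ℝ (W1 N)) =>
    (topDualPairing ℝ (W1 N)).flip x l := ⟨rfl⟩
  rw [hind.tendsto_nhds_iff, tendsto_pi_nhds]
  intro l
  change Tendsto (fun j => l (moserW1 N j)) atTop (𝓝 (l 0))
  rw [map_zero]
  obtain ⟨g, hg, -⟩ := exists_extension_norm_eq (W1 N) l
  obtain ⟨k, hk⟩ : ∃ k, k = g ∘L
    (WithLp.prodContinuousLinearEquiv (N : ℝ≥0∞) ℝ (Lp ℝ (N : ℝ≥0∞) unitMeasure)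
      (Lp ℝ (N : ℝ≥0∞) unitMeasure)).symm.toContinuousLinearMap := ⟨_, rfl⟩
  have h1 : ∀ j, l (moserW1 N j) = (k ∘L ContinuousLinearMap.inl ℝ _ _)
      (memLp_moser hN.out j).toLp + (k ∘L ContinuousLinearMap.inr ℝ _ _)
        (memLp_moserDeriv N j).toLp := by
    intro j
    rw [ContinuousLinearMap.comp_apply, ContinuousLinearMap.comp_apply, ← map_add,
      ContinuousLinearMap.inl_apply, ContinuousLinearMap.inr_apply, Prod.mk_add_mk, add_zero,
      zero_add, ← hg, hk]
    rfl
  simp only [h1]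
  have h2 := ((k ∘L ContinuousLinearMap.inl ℝ _ _).continuous.tendsto 0).comp
    (tendsto_moser_toLp N)
  rw [map_zero] at h2
  simpa using h2.add (tendsto_apply_moserDeriv (k ∘L ContinuousLinearMap.inr ℝ _ _))

/-! ### Asymptotics of the blown-up critical integrand. -/

theorem J_congr {N : ℕ} {γ : ℝ} {u v : ℝ → ℝ} (h : u =ᵐ[unitMeasure] v) :
    J N γ u = J N γ v := by
  refine lintegral_congr_ae ?_
  filter_upwards [h] with x hx
  rw [hx]

theorem J_rep_zero (N : ℕ) [hN : Fact (2 ≤ N)] (γ : ℝ) : J N γ (rep (0 : W1 N)) = 1 := by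
  have h0 : rep (0 : W1 N) =ᵐ[unitMeasure] 0 := Lp.coeFn_zero ℝ (N : ℝ≥0∞) unitMeasure
  have hN0 : N ≠ 0 := by have := hN.out; omega
  rw [J_congr h0]
  simp [J, hN0]

theorem tendsto_mul_one_sub_exp_neg_div (k : ℝ) :
    Tendsto (fun l : ℝ => l * (1 - Real.exp (-(k / l)))) atTop (𝓝 k) := by
  have hd : HasDerivAt (fun u : ℝ => 1 - Real.exp (-(k * u))) k 0 := by
    have h1 : HasDerivAt (fun u : ℝ => -(k * u)) (-k) 0 := by
      have h := ((hasDerivAt_id (0 : ℝ)).const_mul k).neg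
      rw [mul_one] at h
      exact h
    simpa using h1.exp.const_sub 1
  refine (hd.tendsto_slope_zero_right.comp tendsto_inv_atTop_nhdsGT_zero).congr fun l => ?_
  simp [div_eq_mul_inv]

/-- Exponent of the critical integrand in the blown-up logarithmic variable `x`, on the scale `l`. -/
noncomputable def blowUpExponent (σ κ l x : ℝ) : ℝ :=
  1 - (l - σ * x / l) * (1 - Real.exp (-(κ * x / l)))
    + Real.exp (-(κ * x / l)) * Real.log (l - σ * x / l) - Real.log l

theorem tendsto_blowUpExponent (σ κ x : ℝ) :
    Tendsto (fun l => blowUpExponent σ κ l x) atTop (𝓝 (1 - κ * x)) := by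
  have h1 := tendsto_mul_one_sub_exp_neg_div (κ * x)
  have hinv : Tendsto (fun l : ℝ => l⁻¹) atTop (𝓝 0) := tendsto_inv_atTop_zero
  have h2 : Tendsto (fun l : ℝ => 1 - σ * x * (l⁻¹ * l⁻¹)) atTop (𝓝 1) := by
    simpa using (tendsto_const_nhds (x := (1 : ℝ))).sub ((hinv.mul hinv).const_mul (σ * x))
  have h3 : Tendsto (fun l : ℝ => Real.log l / l) atTop (𝓝 0) :=
    Real.isLittleO_log_id_atTop.tendsto_div_nhds_zero
  have h4 : Tendsto (fun l : ℝ => Real.exp (-(κ * x / l))) atTop (𝓝 1) := by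
    have : Tendsto (fun l : ℝ => -(κ * x / l)) atTop (𝓝 0) := by
      simpa [div_eq_mul_inv] using (hinv.const_mul (κ * x)).neg
    simpa using this.rexp
  have h5 : Tendsto (fun l : ℝ => Real.log (1 - σ * x * (l⁻¹ * l⁻¹))) atTop (𝓝 0) := by
    simpa using h2.log one_ne_zero
  have h6 := (((h2.mul h1).const_sub 1).add (h4.mul h5)).sub (h1.mul h3)
  have hlim : (1 - 1 * (κ * x) + 1 * 0 - κ * x * 0) = 1 - κ * x := by ring
  rw [hlim] at h6
  refine h6.congr' ?_
  filter_upwards [eventually_gt_atTop 0, h2.eventually (lt_mem_nhds zero_lt_one)] with l hl hl2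
  have hL : l - σ * x / l = l * (1 - σ * x * (l⁻¹ * l⁻¹)) := by field_simp
  rw [blowUpExponent, hL, Real.log_mul hl.ne' hl2.ne']
  field_simp
  ring

/-- Supplies the integrable majorant for dominated convergence. For l ≥ 2 the perturbed scale l -
σx/l stays between l/2 and 2l, so its logarithm exceeds log l by at most log 2. -/
theorem blowUpExponent_le {σ κ l x : ℝ} (hσ : |σ| ≤ 1) (hκ : 1 ≤ κ) (hl : 2 ≤ l) (hx : 0 ≤ x)
    (hxl : x ≤ l) : blowUpExponent σ κ l x ≤ 1 + Real.log 2 - x / 4 := by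
  have hl0 : 0 < l := by linarith
  have hy0 : 0 ≤ x / l := by positivity
  have hy1 : x / l ≤ 1 := (div_le_one hl0).2 hxl
  rw [abs_le] at hσ
  have hσ1 : -1 ≤ σ * x / l := by rw [mul_div_assoc]; nlinarith
  have hσ2 : σ * x / l ≤ 1 := by rw [mul_div_assoc]; nlinarith
  have hd : x / l / 2 ≤ 1 - Real.exp (-(κ * x / l)) := by
    refine (half_le_one_sub_exp_neg_of_le_one hy0 hy1).trans ?_
    have : x / l ≤ κ * x / l := by rw [mul_div_assoc]; nlinarith
    have := Real.exp_le_exp.2 (neg_le_neg this)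
    linarith
  have h1 : x / 4 ≤ (l - σ * x / l) * (1 - Real.exp (-(κ * x / l))) := by
    calc x / 4 = l / 2 * (x / l / 2) := by field_simp; ring
      _ ≤ _ := mul_le_mul (by linarith) hd (by positivity) (by linarith)
  have hh1 : Real.exp (-(κ * x / l)) ≤ 1 := by linarith
  have hlog0 : 0 ≤ Real.log (l - σ * x / l) := Real.log_nonneg (by linarith)
  have hlog : Real.log (l - σ * x / l) ≤ Real.log 2 + Real.log l := by
    rw [← Real.log_mul (by norm_num) hl0.ne']
    exact Real.log_le_log (by linarith) (by linarith)
  have h2 := mul_le_of_le_one_left hlog0 hh1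
  unfold blowUpExponent
  linarith

theorem tendsto_integral_exp_blowUpExponent {σ κ : ℝ} (hσ : |σ| ≤ 1) (hκ : 1 ≤ κ) :
    Tendsto (fun l => ∫ x in 0..l, Real.exp (blowUpExponent σ κ l x)) atTop
      (𝓝 (Real.exp 1 / κ)) := by
  have hκ0 : 0 < κ := by linarith
  have hlim : ∫ x in Ioi (0 : ℝ), Real.exp (1 - κ * x) = Real.exp 1 / κ := by
    have : ∀ x, Real.exp (1 - κ * x) = Real.exp 1 * Real.exp (-κ * x) := fun x => by
      rw [← Real.exp_add]
      ring_nf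
    simp only [this]
    rw [integral_const_mul, integral_exp_mul_Ioi (by linarith), mul_zero, Real.exp_zero,
      neg_div_neg_eq, mul_one_div]
  rw [← hlim]
  have key : Tendsto (fun l => ∫ x in Ioi (0 : ℝ),
      (Iic l).indicator (fun x => Real.exp (blowUpExponent σ κ l x)) x) atTop
      (𝓝 (∫ x in Ioi (0 : ℝ), Real.exp (1 - κ * x))) := by
    refine tendsto_integral_filter_of_dominated_convergence
      (fun x => Real.exp (1 + Real.log 2) * Real.exp (-(1 / 4) * x)) ?_ ?_ ?_ ?_
    · refine Eventually.of_forall fun l =>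
        (Measurable.indicator ?_ measurableSet_Iic).aestronglyMeasurable
      unfold blowUpExponent
      fun_prop
    · filter_upwards [eventually_ge_atTop 2] with l hl
      filter_upwards [ae_restrict_mem measurableSet_Ioi] with x hx
      by_cases hxl : x ∈ Iic l
      · rw [indicator_of_mem hxl, Real.norm_eq_abs, Real.abs_exp, ← Real.exp_add]
        refine Real.exp_le_exp.2 ((blowUpExponent_le hσ hκ hl (le_of_lt hx) hxl).trans ?_)
        linarith
      · rw [indicator_of_notMem hxl, norm_zero]
        positivity
    · exact (integrableOn_exp_mul_Ioi (by norm_num) 0).const_mul _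
    · refine Eventually.of_forall fun x => ((tendsto_blowUpExponent σ κ x).rexp).congr' ?_
      filter_upwards [eventually_ge_atTop x] with l hl
      rw [indicator_of_mem (mem_Iic.2 hl)]
  refine key.congr' ?_
  filter_upwards [eventually_ge_atTop 0] with l hl
  rw [setIntegral_indicator measurableSet_Iic, Ioi_inter_Iic, intervalIntegral.integral_of_le hl]

/-! ### Splitting the integral at the concentration window. -/

theorem moser_pow_div {N j : ℕ} (hN : 2 ≤ N) (hj : 1 ≤ j) {s : ℝ} (hs : 0 < s) :
    moser N j s ^ N / s ^ (N - 1) =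
      Real.exp (min (Real.log (j * s)) (-(((N - 1 : ℕ) : ℝ) * Real.log (j * s)))) := by
  have hj0 : (0 : ℝ) < j := by exact_mod_cast hj
  have hjs : 0 < j * s := by positivity
  have hcN : ((j : ℝ) ^ (1 / (N : ℝ))) ^ N = j := by
    rw [one_div, Real.rpow_inv_natCast_pow hj0.le (by omega)]
  obtain ⟨m, rfl⟩ : ∃ m, N = m + 1 := ⟨N - 1, by omega⟩
  rw [moser_eq hN, mul_pow, hcN, Nat.add_sub_cancel]
  rcases le_total (j * s) 1 with h | h
  · have hlog := Real.log_nonpos hjs.le h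
    have hm : (0 : ℝ) ≤ m := by positivity
    rw [min_eq_left (by rwa [le_div_iff₀' hj0]), min_eq_left (by nlinarith), Real.exp_log hjs]
    field_simp
    ring
  · have hlog := Real.log_nonneg h
    have hm : (0 : ℝ) ≤ m := by positivity
    rw [min_eq_right (by rwa [div_le_iff₀' hj0]), min_eq_right (by nlinarith), Real.exp_neg,
      Real.exp_nat_mul, Real.exp_log hjs, mul_pow, div_pow, one_pow, pow_succ]
    field_simp

/-- The region where the Moser function `w_j` concentrates. -/
def nearSet (j : ℕ) : Set ℝ := Ioc (1 / (j : ℝ) * Real.exp (-1)) (1 / (j : ℝ) * Real.exp 1)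

theorem measurableSet_nearSet (j : ℕ) : MeasurableSet (nearSet j) := measurableSet_Ioc

theorem mem_nearSet_iff {j : ℕ} (hj : 1 ≤ j) {s : ℝ} (hs : 0 < s) :
    s ∈ nearSet j ↔ -1 < Real.log (j * s) ∧ Real.log (j * s) ≤ 1 := by
  have hj0 : (0 : ℝ) < j := by exact_mod_cast hj
  rw [Real.lt_log_iff_exp_lt (by positivity), Real.log_le_iff_le_exp (by positivity), nearSet,
    mem_Ioc, one_div, inv_mul_lt_iff₀ hj0, le_inv_mul_iff₀ hj0]

theorem nearSet_subset {j : ℕ} (hj : 3 ≤ j) : nearSet j ⊆ Ioo 0 1 := by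
  have hj0 : (3 : ℝ) ≤ j := by exact_mod_cast hj
  intro s hs
  refine ⟨lt_trans (by positivity) hs.1, hs.2.trans_lt ?_⟩
  -- Since e < 3, the condition j ≥ 3 puts the right end e/j of the window below 1.
  have := Real.exp_one_lt_d9
  rw [one_div, inv_mul_lt_iff₀ (by linarith)]
  linarith

/-- The integrand of `J_γ(w_j)`. -/
noncomputable def moserIntegrand (N : ℕ) (γ : ℝ) (j : ℕ) (s : ℝ) : ℝ :=
  Real.exp ((Real.log (Real.exp 1 / s) + γ * Real.log (Real.log (Real.exp 1 / s))) *
    (moser N j s ^ N / s ^ (N - 1)))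

theorem measurable_moserIntegrand {N : ℕ} (hN : 2 ≤ N) (γ : ℝ) (j : ℕ) :
    Measurable (moserIntegrand N γ j) := by
  have := (continuous_moser hN j).measurable
  unfold moserIntegrand
  fun_prop

theorem J_moser_eq_add (N : ℕ) (γ : ℝ) {j : ℕ} (hj : 3 ≤ j) :
    J N γ (moser N j) = (∫⁻ s in nearSet j, ENNReal.ofReal (moserIntegrand N γ j s)) +
      ∫⁻ s in Ioo 0 1, (nearSet j)ᶜ.indicator
        (fun s => ENNReal.ofReal (moserIntegrand N γ j s)) s := by
  rw [setLIntegral_indicator (measurableSet_nearSet j).compl, inter_comm, ← sdiff_eq,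
    ← inter_eq_self_of_subset_right (nearSet_subset hj), sdiff_self_inter,
    lintegral_inter_add_sdiff _ _ (measurableSet_nearSet j)]
  rfl

/-- Change of variables s = (1/j) exp(σx/l) with l = 1 + log j. The sign σ selects the side of 1/j,
and κ is the decay rate there: 1 on the left, N - 1 on the right. The second factor is the absolute
Jacobian. -/
theorem moserIntegrand_one_mul {N j : ℕ} (hN : 2 ≤ N) (hj : 1 ≤ j) {σ κ x : ℝ}
    (hκ : min (σ * x) (-(((N - 1 : ℕ) : ℝ) * (σ * x))) = -(κ * x)) :
    moserIntegrand N 1 j (1 / j * Real.exp (σ * x / (1 + Real.log j))) *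
      (1 / j * Real.exp (σ * x / (1 + Real.log j)) * (1 / (1 + Real.log j))) =
      Real.exp (blowUpExponent σ κ (1 + Real.log j) x) := by
  have hj1 : (1 : ℝ) ≤ j := by exact_mod_cast hj
  have hj0 : (0 : ℝ) < j := by linarith
  obtain ⟨l, hl⟩ : ∃ l, l = 1 + Real.log j := ⟨_, rfl⟩
  have hl0 : 0 < l := by
    have := Real.log_nonneg hj1
    linarith
  rw [← hl]
  obtain ⟨s, hs⟩ : ∃ s, s = 1 / (j : ℝ) * Real.exp (σ * x / l) := ⟨_, rfl⟩
  have hs0 : 0 < s := by rw [hs]; positivity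
  have hlogs : Real.log s = 1 - (l - σ * x / l) := by
    rw [hs, Real.log_mul (by positivity) (by positivity), Real.log_exp, one_div, Real.log_inv, hl]
    ring
  have hlogjs : Real.log (j * s) = σ * x / l := by
    rw [Real.log_mul hj0.ne' hs0.ne', hlogs, hl]
    ring
  have hmin : min (Real.log (j * s)) (-(((N - 1 : ℕ) : ℝ) * Real.log (j * s))) = -(κ * x / l) := by
    rw [hlogjs, ← mul_div_assoc, ← neg_div, min_div_div_right hl0.le, hκ, neg_div]
  rw [← hs, moserIntegrand, moser_pow_div hN hj hs0, hmin, log_exp_one_div hs0, hlogs,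
    ← Real.exp_log hs0, hlogs, one_div, ← Real.exp_log (inv_pos.2 hl0), Real.log_inv,
    ← Real.exp_add, ← Real.exp_add, blowUpExponent]
  congr 1
  ring_nf

theorem continuousOn_moserIntegrand_one {N : ℕ} (hN : 2 ≤ N) (j : ℕ) :
    ContinuousOn (moserIntegrand N 1 j) (Ioc 0 1) := by
  have hm := (continuous_moser hN j).continuousOn (s := Ioc 0 1)
  have hL : ContinuousOn (fun s : ℝ => Real.log (Real.exp 1 / s)) (Ioc 0 1) :=
    (continuousOn_const.div continuousOn_id fun s hs => hs.1.ne').log fun s hs =>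
      (div_pos (Real.exp_pos _) hs.1).ne'
  have hLL : ContinuousOn (fun s : ℝ => Real.log (Real.log (Real.exp 1 / s))) (Ioc 0 1) :=
    hL.log fun s hs => (zero_lt_one.trans_le (one_le_log_exp_one_div hs.1 hs.2)).ne'
  exact ((hL.add (continuousOn_const.mul hLL)).mul ((hm.pow N).div (continuousOn_id.pow _)
    fun s hs => (pow_pos hs.1 _).ne')).rexp

theorem lintegral_nearSet_moserIntegrand_one {N j : ℕ} (hN : 2 ≤ N) (hj : 3 ≤ j) :
    ∫⁻ s in nearSet j, ENNReal.ofReal (moserIntegrand N 1 j s) = ENNReal.ofReal (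
      (∫ x in 0..1 + Real.log j, Real.exp (blowUpExponent (-1) 1 (1 + Real.log j) x)) +
      ∫ x in 0..1 + Real.log j,
        Real.exp (blowUpExponent 1 ((N - 1 : ℕ) : ℝ) (1 + Real.log j) x)) := by
  have hj3 : (3 : ℝ) ≤ j := by exact_mod_cast hj
  have hj0 : (0 : ℝ) < j := by linarith
  obtain ⟨l, hl⟩ : ∃ l, l = 1 + Real.log j := ⟨_, rfl⟩
  have hl0 : 0 < l := by
    have := Real.log_nonneg (by linarith : (1 : ℝ) ≤ j)
    linarith
  have hm : (1 : ℝ) ≤ ((N - 1 : ℕ) : ℝ) := by exact_mod_cast (by omega : 1 ≤ N - 1)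
  have h1 : 1 / (j : ℝ) * Real.exp (-1) ≤ 1 / j := mul_le_of_le_one_right (by positivity)
    (Real.exp_le_one_iff.2 (by norm_num))
  have h2 : 1 / (j : ℝ) ≤ 1 / j * Real.exp 1 := le_mul_of_one_le_right (by positivity)
    (Real.one_le_exp (by norm_num))
  have h3 : 1 / (j : ℝ) * Real.exp 1 ≤ 1 := by
    have := Real.exp_one_lt_d9
    rw [one_div, inv_mul_le_iff₀ hj0]
    linarith
  have hsub : ∀ {a b : ℝ}, 1 / (j : ℝ) * Real.exp (-1) ≤ a → a ≤ b →
      b ≤ 1 / (j : ℝ) * Real.exp 1 → IntervalIntegrable (moserIntegrand N 1 j) volume a b := by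
    intro a b ha hab hb
    refine ((continuousOn_moserIntegrand_one hN j).mono ?_).intervalIntegrable
    rw [uIcc_of_le hab]
    exact fun x hx => ⟨lt_of_lt_of_le (by positivity) (ha.trans hx.1), hx.2.trans (hb.trans h3)⟩
  have hderiv : ∀ σ x : ℝ, HasDerivAt (fun x => 1 / (j : ℝ) * Real.exp (σ * x / l))
      (σ * (1 / j * Real.exp (σ * x / l) * (1 / l))) x := by
    intro σ x
    have h := ((((hasDerivAt_id x).const_mul σ).div_const l).exp).const_mul (1 / (j : ℝ))
    refine h.congr_deriv ?_
    simp only [id]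
    ring
  have hcont : ∀ σ : ℝ, ContinuousOn (fun x => 1 / (j : ℝ) * Real.exp (σ * x / l)) (uIcc 0 l) :=
    fun σ x _ => (hderiv σ x).continuousAt.continuousWithinAt
  have hR : ∫ s in (1 / (j : ℝ))..(1 / j * Real.exp 1), moserIntegrand N 1 j s =
      ∫ x in 0..l, Real.exp (blowUpExponent 1 ((N - 1 : ℕ) : ℝ) l x) := by
    have := intervalIntegral.integral_comp_mul_deriv_of_deriv_nonneg
      (g := moserIntegrand N 1 j) (hcont 1) (fun x _ => hderiv 1 x) (fun x _ => by positivity)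
    simp only [mul_zero, zero_div, Real.exp_zero, mul_one, one_mul, div_self hl0.ne'] at this
    rw [← this]
    refine intervalIntegral.integral_congr fun x hx => ?_
    rw [uIcc_of_le hl0.le] at hx
    have h := moserIntegrand_one_mul hN (by omega : 1 ≤ j) (σ := 1) (x := x)
      (κ := ((N - 1 : ℕ) : ℝ)) (by
        rw [one_mul]
        exact min_eq_right (by nlinarith [hx.1]))
    rw [← hl] at h
    simp only [one_mul] at h
    simp only [Function.comp_apply, h]
  have hLft : ∫ s in (1 / j * Real.exp (-1))..(1 / (j : ℝ)), moserIntegrand N 1 j s =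
      ∫ x in 0..l, Real.exp (blowUpExponent (-1) 1 l x) := by
    have := intervalIntegral.integral_comp_mul_deriv_of_deriv_nonpos
      (g := moserIntegrand N 1 j) (hcont (-1)) (fun x _ => hderiv (-1) x)
      (fun x _ => mul_nonpos_of_nonpos_of_nonneg (by norm_num) (by positivity))
    simp only [mul_zero, zero_div, Real.exp_zero, mul_one] at this
    rw [neg_one_mul, neg_div, div_self hl0.ne'] at this
    rw [intervalIntegral.integral_symm, ← this, ← intervalIntegral.integral_neg]
    refine intervalIntegral.integral_congr fun x hx => ?_
    rw [uIcc_of_le hl0.le] at hx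
    have h := moserIntegrand_one_mul hN (by omega : 1 ≤ j) (σ := -1) (x := x) (κ := 1) (by
        rw [neg_one_mul, one_mul]
        exact min_eq_left (by nlinarith [hx.1]))
    rw [← hl] at h
    simp only [Function.comp_apply, neg_one_mul, mul_neg, neg_neg] at h ⊢
    exact h
  rw [← hl, ← hR, ← hLft, intervalIntegral.integral_add_adjacent_intervals
    (hsub le_rfl h1 h2) (hsub h1 h2 le_rfl), intervalIntegral.integral_of_le (h1.trans h2),
    ofReal_integral_eq_lintegral_ofReal]
  · rfl
  · exact (intervalIntegrable_iff_integrableOn_Ioc_of_le (h1.trans h2)).1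
      (hsub le_rfl (h1.trans h2) le_rfl)
  · exact Eventually.of_forall fun s => (Real.exp_pos _).le

theorem tendsto_lintegral_nearSet_one {N : ℕ} (hN : 2 ≤ N) :
    Tendsto (fun j => ∫⁻ s in nearSet j, ENNReal.ofReal (moserIntegrand N 1 j s)) atTop
      (𝓝 (ENNReal.ofReal (Real.exp 1 + Real.exp 1 / ((N - 1 : ℕ) : ℝ)))) := by
  have hm : (1 : ℝ) ≤ ((N - 1 : ℕ) : ℝ) := by exact_mod_cast (by omega : 1 ≤ N - 1)
  have hl : Tendsto (fun j : ℕ => 1 + Real.log j) atTop atTop :=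
    tendsto_atTop_add_const_left _ _ (Real.tendsto_log_atTop.comp tendsto_natCast_atTop_atTop)
  have h1 := (tendsto_integral_exp_blowUpExponent (σ := -1) (by simp) le_rfl).comp hl
  have h2 := (tendsto_integral_exp_blowUpExponent (σ := 1) (by simp) hm).comp hl
  rw [div_one] at h1
  refine (ENNReal.tendsto_ofReal (h1.add h2)).congr' ?_
  filter_upwards [eventually_ge_atTop 3] with j hj
  exact (lintegral_nearSet_moserIntegrand_one hN hj).symm

/-- Outside the window the quotient is at most 1/e, so exp(weight/e) dominates. For fixed s the
window eventually moves to the left of s and the quotient tends to 0. -/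
theorem tendsto_lintegral_compl_nearSet {N : ℕ} (hN : 2 ≤ N) {γ : ℝ} (hγ : γ ≤ 1) :
    Tendsto (fun j => ∫⁻ s in Ioo 0 1, (nearSet j)ᶜ.indicator
      (fun s => ENNReal.ofReal (moserIntegrand N γ j s)) s) atTop (𝓝 1) := by
  have hm : (1 : ℝ) ≤ ((N - 1 : ℕ) : ℝ) := by exact_mod_cast (by omega : 1 ≤ N - 1)
  have hone : (1 : ℝ≥0∞) = ∫⁻ _ in Ioo (0 : ℝ) 1, 1 := by simp
  rw [hone]
  refine tendsto_lintegral_filter_of_dominated_convergence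
    (fun s => ENNReal.ofReal (Real.exp (Real.exp (-1) * weight s))) ?_ ?_ ?_ ?_
  · exact Eventually.of_forall fun j =>
      (measurable_moserIntegrand hN γ j).ennreal_ofReal.indicator (measurableSet_nearSet j).compl
  · filter_upwards [eventually_ge_atTop 1] with j hj
    filter_upwards [ae_restrict_mem measurableSet_Ioo] with s hs
    by_cases hnear : s ∈ (nearSet j)ᶜ
    swap
    · rw [indicator_of_notMem hnear]
      exact zero_le
    rw [indicator_of_mem hnear]
    refine ENNReal.ofReal_le_ofReal (Real.exp_le_exp.2 ?_)
    rw [moser_pow_div hN hj hs.1]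
    rw [mem_compl_iff, mem_nearSet_iff hj hs.1, not_and_or, not_lt, not_le] at hnear
    have hle : Real.exp (min (Real.log (j * s)) (-(((N - 1 : ℕ) : ℝ) * Real.log (j * s))))
        ≤ Real.exp (-1) := by
      refine Real.exp_le_exp.2 ?_
      rcases hnear with h | h
      · exact (min_le_left _ _).trans h
      · exact (min_le_right _ _).trans (by nlinarith)
    have hLL := Real.log_nonneg (one_le_log_exp_one_div hs.1 hs.2.le)
    calc _ ≤ weight s *
          Real.exp (min (Real.log (j * s)) (-(((N - 1 : ℕ) : ℝ) * Real.log (j * s)))) := by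
          gcongr
          unfold weight
          nlinarith
      _ ≤ weight s * Real.exp (-1) := by
          have := weight_nonneg hs.1 hs.2.le
          gcongr
      _ = _ := mul_comm _ _
  · exact (lintegral_exp_mul_weight_lt_top (Real.exp_pos _).le
      (Real.exp_lt_one_iff.2 (by norm_num))).ne
  · filter_upwards [ae_restrict_mem measurableSet_Ioo] with s hs
    have hlog : Tendsto (fun j : ℕ => Real.log (j * s)) atTop atTop :=
      Real.tendsto_log_atTop.comp (tendsto_natCast_atTop_atTop.atTop_mul_const hs.1)
    have hexp : Tendsto (fun j : ℕ => moser N j s ^ N / s ^ (N - 1)) atTop (𝓝 0) := by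
      have h1 : Tendsto (fun j : ℕ => Real.exp (-(((N - 1 : ℕ) : ℝ) * Real.log (j * s)))) atTop
          (𝓝 0) := Real.tendsto_exp_neg_atTop_nhds_zero.comp
            (hlog.const_mul_atTop (by linarith))
      refine squeeze_zero' ?_ ?_ h1
      · filter_upwards [eventually_ge_atTop 1] with j hj
        rw [moser_pow_div hN hj hs.1]
        positivity
      · filter_upwards [eventually_ge_atTop 1] with j hj
        rw [moser_pow_div hN hj hs.1]
        exact Real.exp_le_exp.2 (min_le_right _ _)
    have h2 : Tendsto (fun j : ℕ => ENNReal.ofReal (moserIntegrand N γ j s)) atTop (𝓝 1) := by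
      have := ENNReal.tendsto_ofReal ((hexp.const_mul
        (Real.log (Real.exp 1 / s) + γ * Real.log (Real.log (Real.exp 1 / s)))).rexp)
      simpa [moserIntegrand] using this
    refine h2.congr' ?_
    filter_upwards [eventually_ge_atTop 1, hlog.eventually_gt_atTop 1] with j hj hj'
    rw [indicator_of_mem]
    rw [mem_compl_iff, mem_nearSet_iff hj hs.1]
    exact fun h => absurd hj' (not_lt.2 h.2)

/-! ### Limits along the Moser functions for each γ. -/

theorem moserIntegrand_eq_one_mul (N : ℕ) (γ : ℝ) (j : ℕ) (s : ℝ) :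
    moserIntegrand N γ j s = Real.exp ((γ - 1) * (moser N j s ^ N / s ^ (N - 1) *
      Real.log (Real.log (Real.exp 1 / s)))) * moserIntegrand N 1 j s := by
  rw [moserIntegrand, moserIntegrand, ← Real.exp_add]
  congr 1
  ring

/-- On the window the quotient is at least exp(-(N-1)) and log(e/s) ≥ log j. The factor separating γ
from the critical case is therefore uniformly small or large. -/
theorem le_moser_pow_div_mul_log {N j : ℕ} (hN : 2 ≤ N) (hj : 3 ≤ j) {s : ℝ}
    (hs : s ∈ nearSet j) :
    Real.exp (-((N - 1 : ℕ) : ℝ)) * Real.log (Real.log j) ≤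
      moser N j s ^ N / s ^ (N - 1) * Real.log (Real.log (Real.exp 1 / s)) := by
  have hj3 : (3 : ℝ) ≤ j := by exact_mod_cast hj
  have hm : (1 : ℝ) ≤ ((N - 1 : ℕ) : ℝ) := by exact_mod_cast (by omega : 1 ≤ N - 1)
  have hs' := nearSet_subset hj hs
  have hs0 := hs'.1
  have hnear := (mem_nearSet_iff (by omega) hs0).1 hs
  have hlogj : 1 ≤ Real.log j := by
    rw [Real.le_log_iff_exp_le (by linarith)]
    linarith [Real.exp_one_lt_d9]
  rw [moser_pow_div hN (by omega) hs0]
  have hL : Real.log j ≤ Real.log (Real.exp 1 / s) := by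
    rw [log_exp_one_div hs0]
    rw [Real.log_mul (by positivity) hs0.ne'] at hnear
    linarith [hnear.2]
  have h1 := Real.log_nonneg hlogj
  gcongr
  refine le_min ?_ ?_
  · linarith [hnear.1]
  · nlinarith [hnear.2]

theorem tendsto_log_log_natCast :
    Tendsto (fun j : ℕ => Real.log (Real.log j)) atTop atTop :=
  Real.tendsto_log_atTop.comp (Real.tendsto_log_atTop.comp tendsto_natCast_atTop_atTop)

theorem tendsto_J_moser_of_lt_one {N : ℕ} (hN : 2 ≤ N) {γ : ℝ} (hγ : γ < 1) :
    Tendsto (fun j : ℕ => J N γ (moser N j)) atTop (𝓝 1) := by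
  have hf : Tendsto (fun j : ℕ => Real.exp ((γ - 1) *
      (Real.exp (-((N - 1 : ℕ) : ℝ)) * Real.log (Real.log j)))) atTop (𝓝 0) :=
    Real.tendsto_exp_atBot.comp ((tendsto_log_log_natCast.const_mul_atTop
      (Real.exp_pos _)).const_mul_atTop_of_neg (sub_neg.2 hγ))
  have hnear : Tendsto (fun j => ∫⁻ s in nearSet j, ENNReal.ofReal (moserIntegrand N γ j s)) atTop
      (𝓝 0) := by
    have hb := ENNReal.Tendsto.mul (ENNReal.tendsto_ofReal hf) (Or.inr ENNReal.ofReal_ne_top)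
      (tendsto_lintegral_nearSet_one hN) (Or.inr ENNReal.ofReal_ne_top)
    rw [ENNReal.ofReal_zero, zero_mul] at hb
    refine tendsto_of_tendsto_of_tendsto_of_le_of_le' tendsto_const_nhds hb
      (Eventually.of_forall fun _ => zero_le) ?_
    filter_upwards [eventually_ge_atTop 3] with j hj
    rw [← lintegral_const_mul' _ _ ENNReal.ofReal_ne_top]
    refine setLIntegral_mono' (measurableSet_nearSet j) fun s hs => ?_
    rw [← ENNReal.ofReal_mul (Real.exp_pos _).le, moserIntegrand_eq_one_mul]
    refine ENNReal.ofReal_le_ofReal (mul_le_mul_of_nonneg_right (Real.exp_le_exp.2 ?_)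
      (Real.exp_pos _).le)
    exact mul_le_mul_of_nonpos_left (le_moser_pow_div_mul_log hN hj hs) (by linarith)
  have h := hnear.add (tendsto_lintegral_compl_nearSet hN hγ.le)
  rw [zero_add] at h
  refine h.congr' ?_
  filter_upwards [eventually_ge_atTop 3] with j hj
  exact (J_moser_eq_add N γ hj).symm

theorem tendsto_J_moser_of_one_lt {N : ℕ} (hN : 2 ≤ N) {γ : ℝ} (hγ : 1 < γ) :
    Tendsto (fun j : ℕ => J N γ (moser N j)) atTop (𝓝 ⊤) := by
  have hf : Tendsto (fun j : ℕ => Real.exp ((γ - 1) *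
      (Real.exp (-((N - 1 : ℕ) : ℝ)) * Real.log (Real.log j)))) atTop atTop :=
    Real.tendsto_exp_atTop.comp ((tendsto_log_log_natCast.const_mul_atTop
      (Real.exp_pos _)).const_mul_atTop (sub_pos.2 hγ))
  have hpos : ENNReal.ofReal (Real.exp 1 + Real.exp 1 / ((N - 1 : ℕ) : ℝ)) ≠ 0 := by
    rw [ne_eq, ENNReal.ofReal_eq_zero, not_le]
    positivity
  have hb := ENNReal.Tendsto.mul (ENNReal.tendsto_ofReal_nhds_top.2 hf) (Or.inl ENNReal.top_ne_zero)
    (tendsto_lintegral_nearSet_one hN) (Or.inl hpos)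
  rw [ENNReal.top_mul hpos] at hb
  refine tendsto_of_tendsto_of_tendsto_of_le_of_le' hb tendsto_const_nhds ?_
    (Eventually.of_forall fun _ => le_top)
  filter_upwards [eventually_ge_atTop 3] with j hj
  rw [J_moser_eq_add N γ hj, ← lintegral_const_mul' _ _ ENNReal.ofReal_ne_top]
  refine le_add_of_le_of_nonneg (setLIntegral_mono' (measurableSet_nearSet j) fun s hs => ?_)
    (zero_le)
  rw [← ENNReal.ofReal_mul (Real.exp_pos _).le, moserIntegrand_eq_one_mul N γ]
  refine ENNReal.ofReal_le_ofReal (mul_le_mul_of_nonneg_right (Real.exp_le_exp.2 ?_)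
    (Real.exp_pos _).le)
  exact mul_le_mul_of_nonneg_left (le_moser_pow_div_mul_log hN hj hs) (by linarith)

theorem tendsto_J_moser_one {N : ℕ} (hN : 2 ≤ N) :
    Tendsto (fun j : ℕ => J N 1 (moser N j)) atTop
      (𝓝 (ENNReal.ofReal (Real.exp 1 + Real.exp 1 / ((N - 1 : ℕ) : ℝ) + 1))) := by
  have h := (tendsto_lintegral_nearSet_one hN).add (tendsto_lintegral_compl_nearSet hN le_rfl)
  rw [← ENNReal.ofReal_one, ← ENNReal.ofReal_add (by positivity) zero_le_one] at h
  refine h.congr' ?_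
  filter_upwards [eventually_ge_atTop 3] with j hj
  exact (J_moser_eq_add N 1 hj).symm

theorem iSup_J_eq_top {N : ℕ} [hN : Fact (2 ≤ N)] {γ : ℝ} (hγ : 1 < γ) :
    (⨆ v ∈ E N, J N γ (rep v)) = ⊤ := by
  refine top_unique (le_of_tendsto (tendsto_J_moser_of_one_lt hN.out hγ) ?_)
  filter_upwards [eventually_ge_atTop 1] with j hj
  rw [← J_congr (rep_moserW1 N j)]
  exact le_iSup₂_of_le _ (moserW1_mem_E N hj) le_rfl

end BlissMoser

theorem theorem1p2 (N : ℕ) [Fact (2 ≤ N)] :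
    (∀ γ : ℝ, (⨆ v ∈ BlissMoser.E N, BlissMoser.J N γ (BlissMoser.rep v)) < ⊤ ↔ γ ≤ 1) ∧
    -- the Moser functions lie in `E_N`, converge weakly to `0` in `W^{1,N}(0,1)`, and `J_1` is
    -- not weakly continuous along them
    (∃ w : ℕ → BlissMoser.W1 N,
      (∀ j : ℕ, 1 ≤ j → w j ∈ BlissMoser.E N ∧
        BlissMoser.rep (w j) =ᵐ[BlissMoser.unitMeasure] BlissMoser.moser N j) ∧
      Tendsto (fun j => toWeakSpace ℝ (BlissMoser.W1 N) (w j)) atTop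
        (𝓝 (toWeakSpace ℝ (BlissMoser.W1 N) 0)) ∧
      ¬ Tendsto (fun j => BlissMoser.J N 1 (BlissMoser.rep (w j))) atTop
        (𝓝 (BlissMoser.J N 1 (BlissMoser.rep (0 : BlissMoser.W1 N))))) ∧
    (∀ γ : ℝ, BlissMoser.J N γ (BlissMoser.rep (0 : BlissMoser.W1 N)) = 1) ∧
    (∀ γ : ℝ, 1 < γ →
      Tendsto (fun j : ℕ => BlissMoser.J N γ (BlissMoser.moser N j)) atTop (𝓝 ⊤)) ∧
    (∃ c : ℝ, Real.exp 1 + 1 ≤ c ∧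
      Tendsto (fun j : ℕ => BlissMoser.J N 1 (BlissMoser.moser N j)) atTop
        (𝓝 (ENNReal.ofReal c))) ∧
    (∀ γ : ℝ, γ < 1 →
      Tendsto (fun j : ℕ => BlissMoser.J N γ (BlissMoser.moser N j)) atTop (𝓝 1)) := by

  have hN2 : 2 ≤ N := Fact.out
  have he : Real.exp 1 + 1 ≤ Real.exp 1 + Real.exp 1 / ((N - 1 : ℕ) : ℝ) + 1 := by
    have : 0 ≤ Real.exp 1 / ((N - 1 : ℕ) : ℝ) := by positivity
    linarith
  refine ⟨fun γ => ⟨fun h => ?_, BlissMoser.iSup_J_lt_top⟩,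
    ⟨BlissMoser.moserW1 N, fun j hj => ⟨BlissMoser.moserW1_mem_E N hj, BlissMoser.rep_moserW1 N j⟩,
      BlissMoser.tendsto_toWeakSpace_moserW1 N, fun h => ?_⟩,
    BlissMoser.J_rep_zero N, fun γ => BlissMoser.tendsto_J_moser_of_one_lt hN2,
    ⟨_, he, BlissMoser.tendsto_J_moser_one hN2⟩,
    fun γ => BlissMoser.tendsto_J_moser_of_lt_one hN2⟩
  · by_contra! hγ
    exact h.ne (BlissMoser.iSup_J_eq_top hγ)
  · rw [BlissMoser.J_rep_zero] at h
    have h' := h.congr fun j => BlissMoser.J_congr (BlissMoser.rep_moserW1 N j)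
    -- Weak continuity would equate 1 with e + e/(N-1) + 1.
    have heq := tendsto_nhds_unique h' (BlissMoser.tendsto_J_moser_one hN2)
    rw [← ENNReal.ofReal_one, ENNReal.ofReal_eq_ofReal_iff zero_le_one (by positivity)] at heq
    linarith [Real.exp_pos 1]
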